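/- Let $P\neq Q$ be points of the plane $\mathbb R^2$ and $N=\mathbb R^2\setminus\{P,Q\}$. *Lines.* A closed polygonal line in $N$ is a nonempty finite sequence $A_1\dots A_m$ ($m\ge 1$) of not necessarily distinct points, considered up to cyclic shift, such that all the segments $A_1A_2,\dots,A_{m-1}A_m,A_mA_1$ lie in $N$. For $m\ge2$, an elementary cancellation of such a line is the removal of a vertex $B$ such that the convex hull of $A,B,C$ lies in $N$, where $A$ and $C$ are the (possibly coinciding) vertices preceding and following $B$. Two lines are homotopic if they can be joined by a finite sequence of closed polygonal lines in $N$ in which, of any two consecutive lines, one is obtained from the other by an elementary cancellation. *Words.* A cyclic word is a finite (possibly empty) word in the letters $a,b,a^{-1},b^{-1}$, considered up to cyclic shift. An elementary cancellation of a cyclic word is the deletion of a subword $aa^{-1}$, $a^{-1}a$, $bb^{-1}$ or $b^{-1}b$. A cyclic word is economical if it has no such subword. An economical form of a cyclic word $w$ is an economical cyclic word obtained from $w$ by a finite (possibly empty) sequence of elementary cancellations. *The Poincaré word.* Let $l=A_1\dots A_m$ be a closed polygonal line in $N$, and let $PP'$ and $QQ'$ be disjoint rays starting at $P$ and $Q$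 that are in general position with respect to $l$, i.e. pass through no vertex of $l$. Moving once along $l$ through $A_1,A_2,\dots,A_m$ and back to $A_1$, write a letter at every intersection of $l$ with the two rays, in the order in which the intersections occur: at an intersection of an oriented segment $\overrightarrow{AB}$ of $l$ with the ray $PP'$ write $a$ if the triangle $ABP$ is oriented clockwise, and $a^{-1}$ otherwise; at an intersection of $\overrightarrow{AB}$ with the ray $QQ'$ write $b$ if $ABQ$ is oriented clockwise, and $b^{-1}$ otherwise. The resulting cyclic word is the cyclic Poincaré word of $l$ with respect to these rays. **Proposition 7.7.** For every closed polygonal line $l$ in $N$ there are disjoint rays $PP'$ and $QQ'$ in general position with respect to $l$. For any such rays, the cyclic Poincaré word of $l$ has a unique economical form $e(l)$, which does not depend on the choice of the rays and depends only on the homotopy class of $l$. The resulting map, sending the homotopy class of $l$ to $e(l)$, is a bijection from the set of homotopy classes of closed polygonal lines in $N$ onto the set of all economical cyclic words. -/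

import Mathlib

namespace PolyLine

/-- The Euclidean plane; only its real affine structure is used below. -/
abbrev Plane : Type := ℝ × ℝ

/-- The plane minus two points. -/
def planeMinus (P Q : Plane) : Set Plane := {X | X ≠ P ∧ X ≠ Q}

/-- A closed (oriented) polygonal line in `N`: a nonempty finite sequence of points up to cyclic
shift, such that for any two cyclically consecutive points the segment joining them lies in `N`.
(For a one-point line the only segment is the point itself.) -/
def ClosedLine (N : Set Plane) : Type :=
  {c : Cycle Plane // c ≠ Cycle.nil ∧ c.Chain (fun A B => segment ℝ A B ⊆ N)}

/-- `ElementaryCancellation N l l₁`: the line `l₁` is obtained from `l` by removal of a vertex `B`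
such that the convex hull of `B` and its two neighbours (which may coincide) lies in `N`. -/
def ElementaryCancellation (N : Set Plane) (l l₁ : ClosedLine N) : Prop :=
  ∃ (B : Plane) (L : List Plane) (hL : L ≠ []),
    l.1 = ((B :: L : List Plane) : Cycle Plane) ∧ l₁.1 = (L : Cycle Plane) ∧
      convexHull ℝ {L.getLast hL, B, L.head hL} ⊆ N

/-- Two lines are homotopic in `N` if they are joined by a finite sequence of lines in `N` in which,
of any two consecutive ones, one is obtained from the other by an elementary cancellation. -/
def homotopySetoid (N : Set Plane) : Setoid (ClosedLine N) :=
  Relation.EqvGen.setoid (ElementaryCancellation N)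

/-- The set of homotopy classes of closed polygonal lines in `N`. -/
def HomotopyClass (N : Set Plane) : Type := Quotient (homotopySetoid N)

/-- The homotopy class of a closed polygonal line. -/
def homotopyClass {N : Set Plane} (l : ClosedLine N) : HomotopyClass N :=
  Quotient.mk (homotopySetoid N) l

/-- The two generators. -/
inductive Gen : Type
  | a
  | b

/-- The four letters: `(a, true)` is the letter a and `(a, false)` is the letter a⁻¹;
likewise for b. -/
abbrev Letter : Type := Gen × Bool

/-- The inverse letter. -/
def Letter.inverse (x : Letter) : Letter := (x.1, !x.2)

/-- A cyclic word is a finite word, possibly empty, up to cyclic shift. -/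
abbrev CyclicWord : Type := Cycle Letter

/-- `w₁` is obtained from `w` by replacing a subword x x⁻¹ by the empty subword,
where x is one of the four letters. -/
def WordCancellation (w w₁ : CyclicWord) : Prop :=
  ∃ (x : Letter) (u : List Letter),
    w = ((x :: x.inverse :: u : List Letter) : CyclicWord) ∧ w₁ = (u : CyclicWord)

/-- A cyclic word is economical if it has no subword x x⁻¹, where x is one of the four letters. -/
def Economical (w : CyclicWord) : Prop :=
  ∀ (x : Letter) (u : List Letter), w ≠ ((x :: x.inverse :: u : List Letter) : CyclicWord)

/-- The set of all economical cyclic words. -/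
def EconomicalWord : Type := {w : CyclicWord // Economical w}

/-- `e` is an economical word obtained from `w` by (zero or more) elementary cancellations. -/
def IsEconomicalForm (w : CyclicWord) (e : EconomicalWord) : Prop :=
  Relation.ReflTransGen WordCancellation w e.1

/-- The closed ray from `O` through `R`. -/
def ray (O R : Plane) : Set Plane := {X | ∃ t : ℝ, 0 ≤ t ∧ X = O + t • (R - O)}

/-- The determinant of `B - A`, `C - A`: negative iff the triangle `ABC` is oriented clockwise. -/
def orient (A B C : Plane) : ℝ :=
  (B.1 - A.1) * (C.2 - A.2) - (B.2 - A.2) * (C.1 - A.1)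

open Classical in
/-- The letters written at the intersection of the oriented segment `AB` with the ray `OR`
(none if they are disjoint): the generator `g` if the sign of the intersection is `+1`, that is,
if `ABO` is oriented clockwise, and its inverse otherwise. If neither `A` nor `B` is on the ray and
`O` is not on the segment, then there is at most one intersection point, and it is transverse. -/
noncomputable def crossing (g : Gen) (O R A B : Plane) : List Letter :=
  if (segment ℝ A B ∩ ray O R).Nonempty then [(g, decide (orient A B O < 0))] else []

open Classical in
/-- The letters written when moving along the segment from `A` to `B`, in the order in which the
rays from `P` (generator a) and from `Q` (generator b) are met. -/
noncomputable def segmentWord (P P' Q Q' A B : Plane) : List Letter :=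
  if ∃ s t : ℝ, 0 ≤ s ∧ s < t ∧ t ≤ 1 ∧
      A + s • (B - A) ∈ ray Q Q' ∧ A + t • (B - A) ∈ ray P P' then
    crossing Gen.b Q Q' A B ++ crossing Gen.a P P' A B
  else
    crossing Gen.a P P' A B ++ crossing Gen.b Q Q' A B

/-- The word written when moving along the closed polygonal line `A₁ … Aₘ` from `A₁` through
`A₂`, …, `Aₘ` back to `A₁`. -/
noncomputable def listWord (P P' Q Q' : Plane) (L : List Plane) : List Letter :=
  (List.zipWith (segmentWord P P' Q Q') L (L.rotate 1)).flatten

theorem listWord_isRotated (P P' Q Q' : Plane) {L M : List Plane} (h : L ~r M) :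
    listWord P P' Q Q' L ~r listWord P P' Q Q' M := by
  obtain ⟨n, rfl⟩ := h
  have key : ∀ (Z : List (List Letter)) (k : ℕ), Z.flatten ~r (Z.rotate k).flatten := by
    intro Z k
    rw [List.rotate_eq_drop_append_take_mod, List.flatten_append]
    conv_lhs => rw [← List.take_append_drop (k % Z.length) Z, List.flatten_append]
    exact List.isRotated_append
  unfold listWord
  rw [List.rotate_rotate, Nat.add_comm, ← List.rotate_rotate,
    ← List.zipWith_rotate_distrib _ _ _ _ (by simp)]
  exact key _ _

/-- The cyclic Poincaré word of a closed polygonal line, with respect to the rays `PP'`, `QQ'`. -/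
noncomputable def poincareWord (P P' Q Q' : Plane) {N : Set Plane} (l : ClosedLine N) :
    CyclicWord :=
  Quotient.map (sa := List.IsRotated.setoid Plane) (sb := List.IsRotated.setoid Letter)
    (listWord P P' Q Q') (fun _ _ h => listWord_isRotated P P' Q Q' h) l.1

/-- `PP'` and `QQ'` are disjoint rays in general position with respect to `l`, that is,
passing through no vertex of `l`. -/
structure GeneralPosition (P P' Q Q' : Plane) {N : Set Plane} (l : ClosedLine N) : Prop where
  left_ne : P' ≠ P
  right_ne : Q' ≠ Q
  disjoint : Disjoint (ray P P') (ray Q Q')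
  left_avoids : ∀ A ∈ l.1, A ∉ ray P P'
  right_avoids : ∀ A ∈ l.1, A ∉ ray Q Q'

end PolyLine

namespace PolyLine

open Filter Topology

/-! Cyclic words modulo cancellation are the conjugacy classes of the free group F on a and b, and
by confluence each class contains exactly one economical word (`isEconomicalForm_iff`,
`wordClass_injective_on_economical`). It therefore suffices to show that the conjugacy class of the
Poincaré word does not depend on the rays, is a complete homotopy invariant, and takes every value.

Independence of the rays. The class of the word is that of a product of a two-point function f(A, B)
with values in F along the closed line. Replacing f(A, B) by g(A)⁻¹ f(A, B) g(B) only conjugates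
this product. Turning one ray about its end point while the other stays fixed is such a replacement
(`isConj_of_change_left`, `isConj_of_change_right`): the crossing numbers with two rays from the
same point differ by a coboundary, which is constant along the other ray. So both rays can be moved
close to the line PQ, pointing away from each other. Their crossings are then recorded by
`lineElement`, which involves P and Q only (`isConj_loopProd_lineElement`).

Invariance. A triangle in N is convex and misses P and Q, so all its crossings with the line PQ
happen in one component of that line minus P and Q. Hence f(A, B) f(B, C) = f(A, C) on it
(`lineElement_mul`), and an elementary cancellation preserves the class.

Completeness and surjectivity. Joining every vertex to a base point deforms a closed line to a
product of standard loops, one for each letter of a word in its class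
(`exists_word_cycleHomotopic`). Rotating or cancelling in the word deforms this product
(`wordPath_cycleHomotopic_of_eqvGen`), so equal classes give homotopic lines; and the product of
loops spelled by w has the class of w (`exists_line_of_word`). -/

/-! ### Cyclic words and conjugacy classes in the free group -/

theorem exists_append_of_isRotated {α : Type*} {l m : List α} (h : l ~r m) :
    ∃ s t, l = s ++ t ∧ m = t ++ s := by
  obtain ⟨n, rfl⟩ := h
  exact ⟨l.take (n % l.length), l.drop (n % l.length), (List.take_append_drop _ _).symm,
    List.rotate_eq_drop_append_take_mod⟩

theorem coe_append_comm {α : Type*} (s t : List α) :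
    ((s ++ t : List α) : Cycle α) = ((t ++ s : List α) : Cycle α) :=
  Cycle.coe_eq_coe.2 List.isRotated_append

theorem Letter.inverse_inverse (x : Letter) : x.inverse.inverse = x := by
  simp [Letter.inverse]

theorem WordCancellation.diamond {w w₁ w₂ : CyclicWord} (h₁ : WordCancellation w w₁)
    (h₂ : WordCancellation w w₂) :
    w₁ = w₂ ∨ ∃ w₃, WordCancellation w₁ w₃ ∧ WordCancellation w₂ w₃ := by
  obtain ⟨x, u, rfl, rfl⟩ := h₁
  obtain ⟨y, v, h, rfl⟩ := h₂
  obtain ⟨s, t, hs, ht⟩ := exists_append_of_isRotated (Cycle.coe_eq_coe.1 h)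
  -- The place where the rotation cuts the word gives the relative position of the two cancelled
  -- pairs. They coincide, or share a letter as in x x⁻¹ x, where both cancellations leave the same
  -- cyclic word, or are disjoint, where each can be performed after the other.
  rcases s with _ | ⟨a, _ | ⟨b, s⟩⟩
  · simp only [List.nil_append, List.append_nil] at hs ht
    rw [← hs] at ht
    simp only [List.cons.injEq] at ht
    exact Or.inl (by rw [ht.2.2])
  · simp only [List.cons_append, List.nil_append, List.cons.injEq] at hs
    obtain ⟨rfl, rfl⟩ := hs
    simp only [List.cons_append, List.cons.injEq] at ht
    obtain ⟨rfl, ht⟩ := ht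
    rw [Letter.inverse_inverse] at ht
    left
    rcases u with _ | ⟨c, u⟩
    · simp only [List.nil_append, List.cons.injEq] at ht
      rw [ht.2]
    · simp only [List.cons_append, List.cons.injEq] at ht
      obtain ⟨rfl, rfl⟩ := ht
      exact coe_append_comm [x] u
  · simp only [List.cons_append, List.cons.injEq] at hs
    obtain ⟨rfl, rfl, rfl⟩ := hs
    rcases t with _ | ⟨c, _ | ⟨d, t⟩⟩
    · simp only [List.nil_append, List.cons.injEq, List.append_nil] at ht ⊢
      exact Or.inl (by rw [ht.2.2])
    · simp only [List.cons_append, List.nil_append, List.cons.injEq] at ht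
      obtain ⟨rfl, h1, rfl⟩ := ht
      left
      rw [← h1, Letter.inverse_inverse]
      exact coe_append_comm s [y]
    · simp only [List.cons_append, List.cons.injEq] at ht
      obtain ⟨rfl, rfl, rfl⟩ := ht
      right
      refine ⟨((t ++ s : List Letter) : CyclicWord), ⟨y, t ++ s, ?_, rfl⟩,
        ⟨x, s ++ t, ?_, coe_append_comm _ _⟩⟩
      · exact coe_append_comm s _
      · exact coe_append_comm t _

theorem WordCancellation.join_of_eqvGen {w w' : CyclicWord}
    (h : Relation.EqvGen WordCancellation w w') :
    Relation.Join (Relation.ReflTransGen WordCancellation) w w' := by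
  have hcr : ∀ a b c : CyclicWord, WordCancellation a b → WordCancellation a c →
      ∃ d, Relation.ReflGen WordCancellation b d ∧ Relation.ReflTransGen WordCancellation c d := by
    intro a b c hb hc
    rcases hb.diamond hc with rfl | ⟨d, h1, h2⟩
    · exact ⟨b, .refl, .refl⟩
    · exact ⟨d, .single h1, .single h2⟩
  have he := Relation.equivalence_join_reflTransGen hcr
  induction h with
  | rel _ _ h => exact ⟨_, .single h, .refl⟩
  | refl _ => exact he.refl _
  | symm _ _ _ ih => exact he.symm ih
  | trans _ _ _ _ _ ih1 ih2 => exact he.trans ih1 ih2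

theorem Economical.eq_of_reflTransGen {w w' : CyclicWord} (hw : Economical w)
    (h : Relation.ReflTransGen WordCancellation w w') : w = w' := by
  induction h using Relation.ReflTransGen.head_induction_on with
  | refl => rfl
  | head h _ _ =>
    obtain ⟨x, u, h, -⟩ := h
    exact absurd h (hw x u)

theorem exists_economicalForm (w : CyclicWord) : ∃ e, IsEconomicalForm w e := by
  induction hn : w.length using Nat.strong_induction_on generalizing w with
  | _ n ih =>
    by_cases hw : Economical w
    · exact ⟨⟨w, hw⟩, .refl⟩
    · simp only [Economical, not_forall, not_not] at hw
      obtain ⟨x, u, h⟩ := hw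
      have hlt : (u : CyclicWord).length < n := by
        rw [← hn, h]
        simp only [Cycle.length_coe, List.length_cons]
        omega
      obtain ⟨e, he⟩ := ih _ hlt (u : CyclicWord) rfl
      exact ⟨e, .head ⟨x, u, h, rfl⟩ he⟩

theorem isConj_mul_comm {G : Type*} [Group G] (g h : G) : IsConj (g * h) (h * g) :=
  isConj_iff.2 ⟨h, by group⟩

/-- The conjugacy class in the free group of a cyclic word. -/
def wordClass (w : CyclicWord) : ConjClasses (FreeGroup Gen) :=
  Quotient.lift (s := List.IsRotated.setoid Letter)
    (fun u : List Letter => ConjClasses.mk (FreeGroup.mk u))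
    (fun u v h => by
      obtain ⟨s, t, rfl, rfl⟩ := exists_append_of_isRotated h
      rw [ConjClasses.mk_eq_mk_iff_isConj, ← FreeGroup.mul_mk, ← FreeGroup.mul_mk]
      exact isConj_mul_comm _ _) w

theorem wordClass_coe (u : List Letter) :
    wordClass (u : CyclicWord) = ConjClasses.mk (FreeGroup.mk u) := rfl

theorem WordCancellation.wordClass_eq {w w' : CyclicWord} (h : WordCancellation w w') :
    wordClass w = wordClass w' := by
  obtain ⟨x, u, rfl, rfl⟩ := h
  rw [wordClass_coe, wordClass_coe]
  congr 1
  exact Quot.sound (FreeGroup.Red.Step.cons_not)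

theorem wordClass_eq_of_reflTransGen {w w' : CyclicWord}
    (h : Relation.ReflTransGen WordCancellation w w') : wordClass w = wordClass w' := by
  induction h with
  | refl => rfl
  | tail _ h ih => exact ih.trans h.wordClass_eq

theorem eqvGen_coe_of_mk_eq {u v : List Letter} (h : FreeGroup.mk u = FreeGroup.mk v) :
    Relation.EqvGen WordCancellation (u : CyclicWord) (v : CyclicWord) := by
  replace h := Quot.eqvGen_exact h
  induction h with
  | rel u v h =>
    obtain ⟨⟩ := h
    rename_i L₁ L₂ x b
    refine .rel _ _ ⟨(x, b), L₂ ++ L₁, ?_, coe_append_comm _ _⟩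
    exact coe_append_comm L₁ _
  | refl _ => exact .refl _
  | symm _ _ _ ih => exact .symm _ _ ih
  | trans _ _ _ _ _ ih1 ih2 => exact .trans _ _ _ ih1 ih2

/-- For cyclic words conjugation is invisible: c u c⁻¹ rotates to u c⁻¹ c, which cancels to u. -/
theorem eqvGen_of_wordClass_eq {w w' : CyclicWord} (h : wordClass w = wordClass w') :
    Relation.EqvGen WordCancellation w w' := by
  induction w using Quotient.inductionOn' with | _ u
  induction w' using Quotient.inductionOn' with | _ v
  replace h : ConjClasses.mk (FreeGroup.mk u) = ConjClasses.mk (FreeGroup.mk v) := h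
  rw [ConjClasses.mk_eq_mk_iff_isConj, isConj_iff] at h
  obtain ⟨g, hg⟩ := h
  obtain ⟨c, rfl⟩ := Quot.exists_rep g
  change FreeGroup.mk c * _ * (FreeGroup.mk c)⁻¹ = _ at hg
  rw [FreeGroup.inv_mk, FreeGroup.mul_mk, FreeGroup.mul_mk] at hg
  refine .trans _ _ _ (.symm _ _ ?_) (eqvGen_coe_of_mk_eq hg)
  change Relation.EqvGen WordCancellation _ (u : CyclicWord)
  rw [List.append_assoc, coe_append_comm, List.append_assoc]
  refine eqvGen_coe_of_mk_eq ?_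
  rw [← FreeGroup.mul_mk, ← FreeGroup.mul_mk, ← FreeGroup.inv_mk, inv_mul_cancel, mul_one]

/-- By confluence two words of the same class have a common reduct, and an economical word has no
reduct but itself. -/
theorem isEconomicalForm_iff {w : CyclicWord} {e : EconomicalWord} :
    IsEconomicalForm w e ↔ wordClass w = wordClass e.1 := by
  refine ⟨wordClass_eq_of_reflTransGen, fun h => ?_⟩
  obtain ⟨w', h1, h2⟩ := WordCancellation.join_of_eqvGen (eqvGen_of_wordClass_eq h)
  rw [← e.2.eq_of_reflTransGen h2] at h1
  exact h1

theorem wordClass_injective_on_economical {e e' : EconomicalWord}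
    (h : wordClass e.1 = wordClass e'.1) : e = e' :=
  Subtype.ext (e.2.eq_of_reflTransGen (isEconomicalForm_iff.2 h))

theorem exists_economical_wordClass_eq (c : ConjClasses (FreeGroup Gen)) :
    ∃ e : EconomicalWord, wordClass e.1 = c := by
  obtain ⟨g, rfl⟩ := ConjClasses.exists_rep c
  obtain ⟨u, rfl⟩ := Quot.exists_rep g
  obtain ⟨e, he⟩ := exists_economicalForm (u : CyclicWord)
  exact ⟨e, (wordClass_eq_of_reflTransGen he).symm⟩

/-! ### Signed crossings of a segment with a ray -/

/-- The determinant of two plane vectors. -/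
def det2 (v w : Plane) : ℝ := v.1 * w.2 - v.2 * w.1

/-- The signed intersection number of a segment with a ray in terms of the determinants of the
direction of the ray with the end points (`p` and `q`) and of the two end points (`δ`). -/
noncomputable def crossingSign (p q δ : ℝ) : ℤ :=
  if 0 < p ∧ q < 0 ∧ δ < 0 then 1 else if p < 0 ∧ 0 < q ∧ 0 < δ then -1 else 0

/-- The indicator of an open wedge. -/
noncomputable def wedgeIndicator (p p' : ℝ) : ℤ := if 0 < p ∧ p' < 0 then 1 else 0

/-- For rays OR and OR' with OR' less than a half turn counterclockwise from OR, p, q and p', q' are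
the determinants of their directions with A and B. Crossing OR' clockwise enters the wedge between
the rays, crossing OR clockwise leaves it. The hypothesis `h` is the Plücker relation with a
positive left side, and `h1` to `h4` follow from A and B avoiding both rays. What remains is a
finite check of sign patterns. -/
theorem crossingSign_sub_of_pos {p q p' q' δ : ℝ} (hδ : 0 < δ) (h : q * p' < p * q')
    (h1 : p = 0 → 0 ≤ p') (h2 : q = 0 → 0 ≤ q') (h3 : p' = 0 → p ≤ 0) (h4 : q' = 0 → q ≤ 0) :
    crossingSign p' q' δ - crossingSign p q δ = wedgeIndicator q q' - wedgeIndicator p p' := by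
  unfold crossingSign wedgeIndicator
  rcases lt_trichotomy p 0 with a | rfl | a <;> rcases lt_trichotomy q 0 with b | rfl | b <;>
  rcases lt_trichotomy p' 0 with c | rfl | c <;> rcases lt_trichotomy q' 0 with d | rfl | d <;>
  first
  | (simp [*, not_lt_of_gt]; done)
  | (exfalso; simp [*, not_le_of_gt] at h1 h2 h3 h4; done)
  | (exfalso; nlinarith)

theorem crossingSign_neg (p q δ : ℝ) :
    crossingSign q p (-δ) = - crossingSign p q δ := by
  unfold crossingSign
  simp only [Left.neg_neg_iff, Left.neg_pos_iff]
  split_ifs <;> first | rfl | (exfalso; grind)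

/-- Reversing the segment exchanges the cases δ > 0 and δ < 0. If δ = 0, both ends lie on one open
half-line from the end point of the rays, so nothing is crossed and the wedge indicators agree. -/
theorem crossingSign_sub {D p q p' q' δ : ℝ} (hD : 0 < D) (h : D * δ = p * q' - q * p')
    (h1 : p = 0 → 0 ≤ p') (h2 : q = 0 → 0 ≤ q') (h3 : p' = 0 → p ≤ 0) (h4 : q' = 0 → q ≤ 0)
    (h0 : δ = 0 → ∃ r : ℝ, 0 < r ∧ q = r * p ∧ q' = r * p') :
    crossingSign p' q' δ - crossingSign p q δ = wedgeIndicator q q' - wedgeIndicator p p' := by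
  rcases lt_trichotomy δ 0 with hδ | hδ | hδ
  · have := crossingSign_sub_of_pos (p := q) (q := p) (p' := q') (q' := p') (δ := -δ)
      (by linarith) (by nlinarith) h2 h1 h4 h3
    rw [crossingSign_neg, crossingSign_neg] at this
    linarith
  · obtain ⟨r, hr, rfl, rfl⟩ := h0 hδ
    have e1 : ∀ x : ℝ, 0 < r * x ↔ 0 < x := fun x => mul_pos_iff_of_pos_left hr
    have e2 : ∀ x : ℝ, r * x < 0 ↔ x < 0 := fun x => by
      rw [mul_neg_iff]; grind
    simp [crossingSign, wedgeIndicator, hδ, e1, e2]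
  · exact crossingSign_sub_of_pos hδ (by nlinarith) h1 h2 h3 h4

theorem orient_eq_det2 (A B O : Plane) : orient A B O = det2 (A - O) (B - O) := by
  simp only [orient, det2, Prod.fst_sub, Prod.snd_sub]; ring

theorem mem_segment_iff_exists {A B X : Plane} :
    X ∈ segment ℝ A B ↔ ∃ s : ℝ, 0 ≤ s ∧ s ≤ 1 ∧ X = A + s • (B - A) := by
  rw [segment_eq_image']
  constructor
  · rintro ⟨s, hs, rfl⟩; exact ⟨s, hs.1, hs.2, rfl⟩
  · rintro ⟨s, h1, h2, rfl⟩; exact ⟨s, ⟨h1, h2⟩, rfl⟩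

theorem exists_smul_of_det2_eq_zero {d v : Plane} (hd : d ≠ 0) (h : det2 d v = 0) :
    ∃ t : ℝ, v = t • d := by
  unfold det2 at h
  by_cases h1 : d.1 = 0
  · have h2 : d.2 ≠ 0 := fun h2 => hd (Prod.ext h1 h2)
    refine ⟨v.2 / d.2, Prod.ext ?_ ?_⟩
    · simp only [h1, zero_mul, zero_sub, neg_eq_zero, mul_eq_zero] at h
      simp [h1, h.resolve_left h2]
    · simp [h2]
  · refine ⟨v.1 / d.1, Prod.ext ?_ ?_⟩
    · simp [h1]
    · simp only [Prod.smul_snd, smul_eq_mul]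
      field_simp
      linarith

theorem mem_ray_of_sub_eq {O R A : Plane} {t : ℝ} (ht : 0 ≤ t) (h : A - O = t • (R - O)) :
    A ∈ ray O R := ⟨t, ht, by rw [← h]; abel⟩

theorem origin_mem_ray (O R : Plane) : O ∈ ray O R := ⟨0, le_rfl, by simp⟩

theorem convex_ray (O R : Plane) : Convex ℝ (ray O R) := by
  rintro _ ⟨s, hs, rfl⟩ _ ⟨t, ht, rfl⟩ a b ha hb hab
  refine ⟨a * s + b * t, by positivity, ?_⟩
  obtain rfl : b = 1 - a := by linarith
  module

theorem segment_inter_ray_nonempty_iff {O R A B : Plane} (hR : R ≠ O) (hA : A ∉ ray O R)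
    (hB : B ∉ ray O R) (hO : O ∉ segment ℝ A B) :
    (segment ℝ A B ∩ ray O R).Nonempty ↔
      (0 < det2 (R - O) (A - O) ∧ det2 (R - O) (B - O) < 0 ∧ orient A B O < 0) ∨
      (det2 (R - O) (A - O) < 0 ∧ 0 < det2 (R - O) (B - O) ∧ 0 < orient A B O) := by
  rw [orient_eq_det2]
  have hd : R - O ≠ 0 := sub_ne_zero.2 hR
  constructor
  · rintro ⟨X, hX, t, ht, hXt⟩
    obtain ⟨s, hs0, hs1, hXs⟩ := mem_segment_iff_exists.1 hX
    have ht0 : 0 < t := by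
      refine ht.lt_of_ne fun h => hO ?_
      rwa [hXt, ← h, zero_smul, add_zero] at hX
    have hs0' : 0 < s := by
      refine hs0.lt_of_ne fun h => hA ?_
      rw [← h, zero_smul, add_zero] at hXs
      exact ⟨t, ht, by rw [← hXs, hXt]⟩
    have hs1' : s < 1 := by
      refine hs1.lt_of_ne fun h => hB ?_
      rw [h, one_smul, add_sub_cancel] at hXs
      exact ⟨t, ht, by rw [← hXs, hXt]⟩
    rw [hXt] at hXs
    have e1 := congrArg Prod.fst hXs
    have e2 := congrArg Prod.snd hXs
    simp only [Prod.fst_add, Prod.snd_add, Prod.smul_fst, Prod.smul_snd, smul_eq_mul,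
      Prod.fst_sub, Prod.snd_sub] at e1 e2
    -- The point of intersection is A + s(B - A) = O + t(R - O). Taking determinants of this
    -- equation with R - O and with A - O gives `k1` and `k2`, which determine the signs.
    have k1 : (1 - s) * det2 (R - O) (A - O) + s * det2 (R - O) (B - O) = 0 := by
      simp only [det2, Prod.fst_sub, Prod.snd_sub]
      linear_combination (R.2 - O.2) * e1 - (R.1 - O.1) * e2
    have k2 : s * det2 (A - O) (B - O) = - (t * det2 (R - O) (A - O)) := by
      simp only [det2, Prod.fst_sub, Prod.snd_sub]
      linear_combination (A.2 - O.2) * e1 - (A.1 - O.1) * e2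
    rcases lt_trichotomy (det2 (R - O) (A - O)) 0 with h | h | h
    · right
      refine ⟨h, ?_, ?_⟩ <;> by_contra! h' <;> nlinarith
    -- Here A and B are both on the line of the ray, hence on the half-line opposite to it, and so
    -- is every point between them.
    · exfalso
      have hq : det2 (R - O) (B - O) = 0 := by
        rw [h, mul_zero, zero_add] at k1
        exact (mul_eq_zero.1 k1).resolve_left hs0'.ne'
      obtain ⟨a, ha⟩ := exists_smul_of_det2_eq_zero hd h
      obtain ⟨b, hb⟩ := exists_smul_of_det2_eq_zero hd hq
      have ha0 : a < 0 := by
        by_contra! h'; exact hA (mem_ray_of_sub_eq h' ha)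
      have hb0 : b < 0 := by
        by_contra! h'; exact hB (mem_ray_of_sub_eq h' hb)
      have : ((1 - s) * a + s * b - t) • (R - O) = 0 := by
        have : ((1 - s) * a + s * b - t) • (R - O) = (1 - s) • (A - O) + s • (B - O)
            - t • (R - O) := by rw [ha, hb]; module
        rw [this]
        have h2 : t • (R - O) = A + s • (B - A) - O := by rw [← hXs]; abel
        rw [h2]; module
      have := (smul_eq_zero.1 this).resolve_right hd
      nlinarith
    · left
      refine ⟨h, ?_, ?_⟩ <;> by_contra! h' <;> nlinarith
  · intro h
    set p := det2 (R - O) (A - O) with hp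
    set q := det2 (R - O) (B - O) with hq
    set δ := det2 (A - O) (B - O) with hδ
    have hpq : p - q ≠ 0 := by rcases h with h | h <;> intro h' <;> linarith
    have hs : 0 ≤ p / (p - q) ∧ p / (p - q) ≤ 1 ∧ 0 ≤ -δ / (p - q) := by
      rcases h with ⟨h1, h2, h3⟩ | ⟨h1, h2, h3⟩
      · have : 0 < p - q := by linarith
        exact ⟨by positivity, by rw [div_le_one this]; linarith,
          div_nonneg (by linarith) this.le⟩
      · have : p - q < 0 := by linarith
        exact ⟨div_nonneg_of_nonpos h1.le this.le, by rw [div_le_one_of_neg this]; linarith,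
          div_nonneg_of_nonpos (by linarith) this.le⟩
    -- These parameters solve the two determinant equations for s and t.
    refine ⟨_, mem_segment_iff_exists.2 ⟨p / (p - q), hs.1, hs.2.1, rfl⟩, -δ / (p - q), hs.2.2, ?_⟩
    ext <;>
    · simp only [Prod.fst_add, Prod.snd_add, Prod.smul_fst, Prod.smul_snd, smul_eq_mul,
        Prod.fst_sub, Prod.snd_sub]
      field_simp
      simp only [hp, hq, hδ, det2, Prod.fst_sub, Prod.snd_sub]
      ring

/-- The element of the free group given by the crossing of a segment with a ray. -/
noncomputable def crossingElement (g : Gen) (O R A B : Plane) : FreeGroup Gen :=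
  FreeGroup.mk (crossing g O R A B)

theorem crossingElement_eq {O R A B : Plane} (g : Gen) (hR : R ≠ O) (hA : A ∉ ray O R)
    (hB : B ∉ ray O R) (hO : O ∉ segment ℝ A B) :
    crossingElement g O R A B = FreeGroup.of g ^
      crossingSign (det2 (R - O) (A - O)) (det2 (R - O) (B - O)) (orient A B O) := by
  unfold crossingElement crossing crossingSign
  rw [segment_inter_ray_nonempty_iff hR hA hB hO]
  by_cases h1 : 0 < det2 (R - O) (A - O) ∧ det2 (R - O) (B - O) < 0 ∧ orient A B O < 0
  · simp [h1, FreeGroup.of]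
  · by_cases h2 : det2 (R - O) (A - O) < 0 ∧ 0 < det2 (R - O) (B - O) ∧ 0 < orient A B O
    · simp [h2, FreeGroup.of, FreeGroup.inv_mk, not_lt_of_gt h2.1, not_lt_of_gt h2.2.2,
        FreeGroup.invRev]
    · rw [if_neg (by tauto), if_neg h1, if_neg h2, zpow_zero, FreeGroup.one_eq_mk]

theorem exists_pos_of_orient_eq_zero {O A B : Plane} (hO : O ∉ segment ℝ A B)
    (h : orient A B O = 0) : ∃ r : ℝ, 0 < r ∧ B - O = r • (A - O) := by
  rw [orient_eq_det2] at h
  have hA : A - O ≠ 0 := fun h => hO (by rw [← sub_eq_zero.1 h]; exact left_mem_segment ℝ A B)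
  obtain ⟨r, hr⟩ := exists_smul_of_det2_eq_zero hA h
  refine ⟨r, ?_, hr⟩
  by_contra! hr0
  -- If r ≤ 0, then O divides the segment AB at the parameter 1 / (1 - r).
  refine hO (mem_segment_iff_exists.2 ⟨1 / (1 - r), by apply one_div_nonneg.2; linarith, ?_, ?_⟩)
  · rw [div_le_one (by linarith)]; linarith
  · have hB : B - A = (r - 1) • (A - O) := by
      rw [sub_smul, ← hr]; simp
    rw [hB, smul_smul]
    have : 1 / (1 - r) * (r - 1) = -1 := by
      have : 1 - r ≠ 0 := by linarith
      field_simp; ring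
    rw [this]; simp

theorem det2_smul_right (d v : Plane) (r : ℝ) : det2 d (r • v) = r * det2 d v := by
  simp only [det2, Prod.smul_fst, Prod.smul_snd, smul_eq_mul]; ring

theorem det2_smul_left (d v : Plane) (r : ℝ) : det2 (r • d) v = r * det2 d v := by
  simp only [det2, Prod.smul_fst, Prod.smul_snd, smul_eq_mul]; ring

theorem det2_self (d : Plane) : det2 d d = 0 := by
  simp only [det2]; ring

theorem det2_swap (d v : Plane) : det2 v d = - det2 d v := by
  simp only [det2]; ring

/-! ### Turning a ray about its end point -/

theorem crossing_gauge_of_pos {O R R' : Plane} (hD : 0 < det2 (R - O) (R' - O)) :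
    ∃ G : Plane → ℤ, ∀ A B : Plane, A ∉ ray O R → A ∉ ray O R' → B ∉ ray O R → B ∉ ray O R' →
      O ∉ segment ℝ A B →
      crossingSign (det2 (R' - O) (A - O)) (det2 (R' - O) (B - O)) (orient A B O)
        - crossingSign (det2 (R - O) (A - O)) (det2 (R - O) (B - O)) (orient A B O)
        = G B - G A := by
  refine ⟨fun A => wedgeIndicator (det2 (R - O) (A - O)) (det2 (R' - O) (A - O)),
    fun A B hA hA' hB hB' hO => ?_⟩
  have hR : R - O ≠ 0 := fun h => by rw [h] at hD; simp [det2] at hD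
  have hR' : R' - O ≠ 0 := fun h => by rw [h] at hD; simp [det2] at hD
  have aux : ∀ A, A ∉ ray O R → det2 (R - O) (A - O) = 0 → 0 ≤ det2 (R' - O) (A - O) := by
    intro A hA h
    obtain ⟨t, ht⟩ := exists_smul_of_det2_eq_zero hR h
    have : t < 0 := by by_contra! h'; exact hA (mem_ray_of_sub_eq h' ht)
    rw [ht, det2_smul_right, det2_swap]
    nlinarith
  have aux' : ∀ A, A ∉ ray O R' → det2 (R' - O) (A - O) = 0 → det2 (R - O) (A - O) ≤ 0 := by
    intro A hA h
    obtain ⟨t, ht⟩ := exists_smul_of_det2_eq_zero hR' h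
    have : t < 0 := by by_contra! h'; exact hA (mem_ray_of_sub_eq h' ht)
    rw [ht, det2_smul_right]
    nlinarith
  refine crossingSign_sub hD ?_ (aux A hA) (aux B hB) (aux' A hA') (aux' B hB') ?_
  · rw [orient_eq_det2]; simp only [det2]; ring
  · intro h
    obtain ⟨r, hr, e⟩ := exists_pos_of_orient_eq_zero hO h
    exact ⟨r, hr, by rw [e, det2_smul_right], by rw [e, det2_smul_right]⟩

/-- The intersection numbers with two rays from the same point differ by a coboundary. -/
theorem crossing_gauge {O R R' : Plane} (hR : R ≠ O) (hR' : R' ≠ O) :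
    ∃ G : Plane → ℤ, ∀ A B : Plane, A ∉ ray O R → A ∉ ray O R' → B ∉ ray O R → B ∉ ray O R' →
      O ∉ segment ℝ A B →
      crossingSign (det2 (R' - O) (A - O)) (det2 (R' - O) (B - O)) (orient A B O)
        - crossingSign (det2 (R - O) (A - O)) (det2 (R - O) (B - O)) (orient A B O)
        = G B - G A := by
  rcases lt_trichotomy (det2 (R - O) (R' - O)) 0 with h | h | h
  · obtain ⟨G, hG⟩ := crossing_gauge_of_pos (O := O) (R := R') (R' := R)
      (by rw [det2_swap]; linarith)
    refine ⟨fun A => - G A, fun A B h1 h2 h3 h4 h5 => ?_⟩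
    have := hG A B h2 h1 h4 h3 h5
    linarith
  · obtain ⟨t, ht⟩ := exists_smul_of_det2_eq_zero (sub_ne_zero.2 hR) h
    have ht0 : t ≠ 0 := by rintro rfl; exact hR' (sub_eq_zero.1 (by simpa using ht))
    simp only [ht, det2_smul_left]
    rcases lt_or_gt_of_ne ht0 with ht0 | ht0
    -- The two rays are opposite and together form a line missing A and B, so the indicator of one
    -- of its sides serves as potential.
    · refine ⟨fun A => if 0 < det2 (R - O) (A - O) then 1 else 0, fun A B hA hA' hB hB' hO => ?_⟩
      have aux : ∀ A, A ∉ ray O R → A ∉ ray O R' → det2 (R - O) (A - O) ≠ 0 := by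
        intro A hA hA' h
        obtain ⟨r, hr⟩ := exists_smul_of_det2_eq_zero (sub_ne_zero.2 hR) h
        rcases le_total 0 r with h0 | h0
        · exact hA (mem_ray_of_sub_eq h0 hr)
        · refine hA' (mem_ray_of_sub_eq (t := r / t) (div_nonneg_of_nonpos h0 ht0.le) ?_)
          rw [hr, ht, smul_smul, div_mul_cancel₀ _ ht0.ne]
      have hp := aux A hA hA'
      have hq := aux B hB hB'
      have e1 : ∀ x : ℝ, 0 < t * x ↔ x < 0 := fun x => by rw [mul_pos_iff]; grind
      have e2 : ∀ x : ℝ, t * x < 0 ↔ 0 < x := fun x => by rw [mul_neg_iff]; grind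
      have h0 : orient A B O = 0 → ∃ r : ℝ, 0 < r ∧
          det2 (R - O) (B - O) = r * det2 (R - O) (A - O) := by
        intro h
        obtain ⟨r, hr, e⟩ := exists_pos_of_orient_eq_zero hO h
        exact ⟨r, hr, by rw [e, det2_smul_right]⟩
      simp only [crossingSign, e1, e2]
      generalize det2 (R - O) (A - O) = p at *
      generalize det2 (R - O) (B - O) = q at *
      generalize orient A B O = δ at *
      rcases lt_trichotomy δ 0 with hδ | hδ | hδ
      · rcases lt_or_gt_of_ne hp with hp | hp <;> rcases lt_or_gt_of_ne hq with hq | hq <;>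
          simp [hp, hq, hδ, not_lt_of_gt]
      · obtain ⟨r, hr, rfl⟩ := h0 hδ
        simp [hδ, mul_pos_iff_of_pos_left hr]
      · rcases lt_or_gt_of_ne hp with hp | hp <;> rcases lt_or_gt_of_ne hq with hq | hq <;>
          simp [hp, hq, hδ, not_lt_of_gt]
    · refine ⟨fun _ => 0, fun A B _ _ _ _ _ => ?_⟩
      have e1 : ∀ x : ℝ, 0 < t * x ↔ 0 < x := fun x => mul_pos_iff_of_pos_left ht0
      have e2 : ∀ x : ℝ, t * x < 0 ↔ x < 0 := fun x => by rw [mul_neg_iff]; grind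
      simp [crossingSign, e1, e2]
  · exact crossing_gauge_of_pos h

/-- The second clause makes the potential constant along any segment that meets neither ray, in
particular along the ray from the other puncture. -/
theorem exists_gauge (g : Gen) {O R R' : Plane} (hR : R ≠ O) (hR' : R' ≠ O) :
    ∃ G : Plane → ℤ, ∀ A B : Plane, A ∉ ray O R → A ∉ ray O R' → B ∉ ray O R → B ∉ ray O R' →
      O ∉ segment ℝ A B →
      (crossingElement g O R' A B =
        (FreeGroup.of g ^ G A)⁻¹ * crossingElement g O R A B * FreeGroup.of g ^ G B) ∧
      (¬ (segment ℝ A B ∩ ray O R).Nonempty → ¬ (segment ℝ A B ∩ ray O R').Nonempty →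
        G A = G B) := by
  obtain ⟨G, hG⟩ := crossing_gauge hR hR'
  refine ⟨G, fun A B h1 h2 h3 h4 h5 => ?_⟩
  have h := hG A B h1 h2 h3 h4 h5
  constructor
  · rw [crossingElement_eq g hR h1 h3 h5, crossingElement_eq g hR' h2 h4 h5, ← zpow_neg,
      ← zpow_add, ← zpow_add]
    congr 1
    linarith
  · intro k k'
    rw [segment_inter_ray_nonempty_iff hR h1 h3 h5] at k
    rw [segment_inter_ray_nonempty_iff hR' h2 h4 h5] at k'
    push Not at k k'
    unfold crossingSign at h
    rw [if_neg (by grind), if_neg (by grind), if_neg (by grind), if_neg (by grind)] at h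
    linarith

/-! ### Cutting the word of a segment at a crossing -/

theorem mem_of_convex_of_le {S : Set Plane} (hS : Convex ℝ S) {A B : Plane} {r s t : ℝ}
    (hr : A + r • (B - A) ∈ S) (ht : A + t • (B - A) ∈ S) (h1 : r ≤ s) (h2 : s ≤ t) :
    A + s • (B - A) ∈ S := by
  have h := (hS.affine_preimage (AffineMap.lineMap (k := ℝ) A B)).ordConnected.out
    (x := r) (y := t)
  simp only [Set.mem_preimage, AffineMap.lineMap_apply, vsub_eq_sub, vadd_eq_add] at h
  rw [add_comm] at hr ht ⊢
  simpa [AffineMap.lineMap_apply] using h hr ht ⟨h1, h2⟩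

theorem orient_initial (A B O : Plane) (s : ℝ) :
    orient A (A + s • (B - A)) O = s * orient A B O := by
  simp only [orient, Prod.fst_add, Prod.snd_add, Prod.smul_fst, Prod.smul_snd, smul_eq_mul,
    Prod.fst_sub, Prod.snd_sub]
  ring

theorem orient_final (A B O : Plane) (s : ℝ) :
    orient (A + s • (B - A)) B O = (1 - s) * orient A B O := by
  simp only [orient, Prod.fst_add, Prod.snd_add, Prod.smul_fst, Prod.smul_snd, smul_eq_mul,
    Prod.fst_sub, Prod.snd_sub]
  ring

theorem mem_segment_initial {A B X : Plane} {s : ℝ} (hs : 0 ≤ s) :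
    X ∈ segment ℝ A (A + s • (B - A)) ↔ ∃ r, 0 ≤ r ∧ r ≤ s ∧ X = A + r • (B - A) := by
  rw [mem_segment_iff_exists]
  constructor
  · rintro ⟨r, h0, h1, rfl⟩
    exact ⟨r * s, by positivity, by nlinarith, by module⟩
  · rintro ⟨r, h0, h1, rfl⟩
    rcases hs.eq_or_lt with rfl | hs
    · obtain rfl : r = 0 := le_antisymm h1 h0
      exact ⟨0, le_rfl, zero_le_one, by module⟩
    · refine ⟨r / s, by positivity, by rw [div_le_one hs]; exact h1, ?_⟩
      rw [add_sub_cancel_left, smul_smul, div_mul_cancel₀ _ hs.ne']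

theorem mem_segment_final {A B X : Plane} {s : ℝ} (hs : s ≤ 1) :
    X ∈ segment ℝ (A + s • (B - A)) B ↔ ∃ r, s ≤ r ∧ r ≤ 1 ∧ X = A + r • (B - A) := by
  rw [segment_symm]
  have e : A + s • (B - A) = B + (1 - s) • (A - B) := by module
  rw [e, mem_segment_initial (by linarith)]
  constructor
  · rintro ⟨r, h0, h1, rfl⟩
    exact ⟨1 - r, by linarith, by linarith, by module⟩
  · rintro ⟨r, h0, h1, rfl⟩
    exact ⟨1 - r, by linarith, by linarith, by module⟩

theorem crossingElement_eq_one {g : Gen} {O R A B : Plane}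
    (h : ¬ (segment ℝ A B ∩ ray O R).Nonempty) : crossingElement g O R A B = 1 := by
  rw [crossingElement, crossing, if_neg h, FreeGroup.one_eq_mk]

theorem exists_crossingElement_eq_zpow (g : Gen) (O R A B : Plane) :
    ∃ m : ℤ, crossingElement g O R A B = FreeGroup.of g ^ m := by
  unfold crossingElement crossing
  split_ifs
  · rcases decide (orient A B O < 0) with _ | _
    · exact ⟨-1, by simp [FreeGroup.of, FreeGroup.inv_mk, FreeGroup.invRev]⟩
    · exact ⟨1, by simp [FreeGroup.of]⟩
  · exact ⟨0, by rw [zpow_zero, FreeGroup.one_eq_mk]⟩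

theorem crossingElement_of_meet {g : Gen} {O R A B : Plane}
    (h : (segment ℝ A B ∩ ray O R).Nonempty) :
    crossingElement g O R A B = FreeGroup.mk [(g, decide (orient A B O < 0))] := by
  rw [crossingElement, crossing, if_pos h]

section Subsegments

variable {g : Gen} {O R A B : Plane} {s t : ℝ}

theorem crossingElement_initial_of_mem (hA : A ∉ ray O R) (hs1 : s ≤ 1) (ht0 : 0 ≤ t)
    (hts : t ≤ s) (ht : A + t • (B - A) ∈ ray O R) :
    crossingElement g O R A (A + s • (B - A)) = crossingElement g O R A B := by
  have hs : 0 < s := by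
    by_contra! h
    obtain rfl : t = 0 := by linarith
    simp at ht
    exact hA ht
  rw [crossingElement_of_meet ⟨_, (mem_segment_initial hs.le).2 ⟨t, ht0, hts, rfl⟩, ht⟩,
    crossingElement_of_meet
      ⟨_, mem_segment_iff_exists.2 ⟨t, ht0, hts.trans hs1, rfl⟩, ht⟩, orient_initial]
  congr 4
  rw [mul_neg_iff]
  grind

theorem crossingElement_final_of_mem (hB : B ∉ ray O R) (hs0 : 0 ≤ s) (ht1 : t ≤ 1)
    (hts : s ≤ t) (ht : A + t • (B - A) ∈ ray O R) :
    crossingElement g O R (A + s • (B - A)) B = crossingElement g O R A B := by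
  have hs : s < 1 := by
    by_contra! h
    obtain rfl : t = 1 := by linarith
    simp at ht
    exact hB ht
  rw [crossingElement_of_meet ⟨_, (mem_segment_final hs.le).2 ⟨t, hts, ht1, rfl⟩, ht⟩,
    crossingElement_of_meet
      ⟨_, mem_segment_iff_exists.2 ⟨t, hs0.trans hts, ht1, rfl⟩, ht⟩, orient_final]
  congr 4
  rw [mul_neg_iff]
  grind

theorem crossingElement_initial_eq_one (hs : 0 ≤ s)
    (h : ∀ r, 0 ≤ r → r ≤ s → A + r • (B - A) ∉ ray O R) :
    crossingElement g O R A (A + s • (B - A)) = 1 := by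
  refine crossingElement_eq_one ?_
  rintro ⟨X, hX, hX'⟩
  obtain ⟨r, h0, h1, rfl⟩ := (mem_segment_initial hs).1 hX
  exact h r h0 h1 hX'

theorem crossingElement_final_eq_one (hs : s ≤ 1)
    (h : ∀ r, s ≤ r → r ≤ 1 → A + r • (B - A) ∉ ray O R) :
    crossingElement g O R (A + s • (B - A)) B = 1 := by
  refine crossingElement_eq_one ?_
  rintro ⟨X, hX, hX'⟩
  obtain ⟨r, h0, h1, rfl⟩ := (mem_segment_final hs).1 hX
  exact h r h0 h1 hX'

end Subsegments

/-- The element of the free group given by the word of a segment. -/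
noncomputable def segmentElement (P P' Q Q' A B : Plane) : FreeGroup Gen :=
  FreeGroup.mk (segmentWord P P' Q Q' A B)

section Splitting

variable {P P' Q Q' A B : Plane} {s t : ℝ}

theorem segmentElement_of_not_meet_right (h : ¬ (segment ℝ A B ∩ ray Q Q').Nonempty) :
    segmentElement P P' Q Q' A B = crossingElement .a P P' A B := by
  unfold segmentElement segmentWord crossingElement
  have : crossing .b Q Q' A B = [] := if_neg h
  rw [this]
  simp

theorem segmentElement_of_not_meet_left (h : ¬ (segment ℝ A B ∩ ray P P').Nonempty) :
    segmentElement P P' Q Q' A B = crossingElement .b Q Q' A B := by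
  unfold segmentElement segmentWord crossingElement
  have : crossing .a P P' A B = [] := if_neg h
  rw [this]
  simp

theorem segmentElement_of_lt (hs : 0 ≤ s) (hst : s < t) (ht : t ≤ 1)
    (hsQ : A + s • (B - A) ∈ ray Q Q') (htP : A + t • (B - A) ∈ ray P P') :
    segmentElement P P' Q Q' A B = crossingElement .b Q Q' A B * crossingElement .a P P' A B := by
  unfold segmentElement segmentWord crossingElement
  rw [if_pos ⟨s, t, hs, hst, ht, hsQ, htP⟩, FreeGroup.mul_mk]

theorem segmentElement_of_gt (hd : Disjoint (ray P P') (ray Q Q')) (hst : t < s)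
    (hsQ : A + s • (B - A) ∈ ray Q Q') (htP : A + t • (B - A) ∈ ray P P') :
    segmentElement P P' Q Q' A B = crossingElement .a P P' A B * crossingElement .b Q Q' A B := by
  unfold segmentElement segmentWord crossingElement
  rw [if_neg, FreeGroup.mul_mk]
  rintro ⟨s', t', -, h, -, hs', ht'⟩
  rw [Set.disjoint_left] at hd
  -- If the crossings also occurred in the opposite order, then by convexity one ray would contain a
  -- point of the other.
  rcases le_total t' s with h1 | h1
  · exact hd ht' (mem_of_convex_of_le (convex_ray _ _) hs' hsQ h.le h1)
  · exact hd (mem_of_convex_of_le (convex_ray _ _) htP ht' hst.le h1) hsQ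

/-- At most one of the two outer factors is nontrivial: if the ray from P met the segment on both
sides of the cut, by convexity it would contain the cut point, which is on the disjoint ray from Q.
Cutting here allows a gauge in powers of a to be applied before and after the letter b separately.
-/
theorem segmentElement_split_right (hd : Disjoint (ray P P') (ray Q Q')) (hA : A ∉ ray P P')
    (hB : B ∉ ray P P') (hs0 : 0 ≤ s) (hs1 : s ≤ 1) (hs : A + s • (B - A) ∈ ray Q Q') :
    segmentElement P P' Q Q' A B = crossingElement .a P P' A (A + s • (B - A)) *
      crossingElement .b Q Q' A B * crossingElement .a P P' (A + s • (B - A)) B := by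
  by_cases h : (segment ℝ A B ∩ ray P P').Nonempty
  · obtain ⟨Y, hY, hYP⟩ := h
    obtain ⟨t, ht0, ht1, rfl⟩ := mem_segment_iff_exists.1 hY
    rcases lt_trichotomy s t with h | rfl | h
    · rw [segmentElement_of_lt hs0 h ht1 hs hYP,
        crossingElement_final_of_mem hB hs0 ht1 h.le hYP, crossingElement_initial_eq_one hs0,
        one_mul]
      intro r _ hr hr'
      exact Set.disjoint_left.1 hd (mem_of_convex_of_le (convex_ray _ _) hr' hYP hr h.le) hs
    · exact absurd hs (Set.disjoint_left.1 hd hYP)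
    · rw [segmentElement_of_gt hd h hs hYP,
        crossingElement_initial_of_mem hA hs1 ht0 h.le hYP, crossingElement_final_eq_one hs1,
        mul_one]
      intro r hr _ hr'
      exact Set.disjoint_left.1 hd (mem_of_convex_of_le (convex_ray _ _) hYP hr' h.le hr) hs
  · rw [segmentElement_of_not_meet_left h, crossingElement_initial_eq_one hs0,
      crossingElement_final_eq_one hs1, one_mul, mul_one]
    · exact fun r h0 h1 hr => h ⟨_, mem_segment_iff_exists.2 ⟨r, by linarith, h1, rfl⟩, hr⟩
    · exact fun r h0 h1 hr => h ⟨_, mem_segment_iff_exists.2 ⟨r, h0, by linarith, rfl⟩, hr⟩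

theorem segmentElement_split_left (hd : Disjoint (ray P P') (ray Q Q')) (hA : A ∉ ray Q Q')
    (hB : B ∉ ray Q Q') (ht0 : 0 ≤ t) (ht1 : t ≤ 1) (ht : A + t • (B - A) ∈ ray P P') :
    segmentElement P P' Q Q' A B = crossingElement .b Q Q' A (A + t • (B - A)) *
      crossingElement .a P P' A B * crossingElement .b Q Q' (A + t • (B - A)) B := by
  by_cases h : (segment ℝ A B ∩ ray Q Q').Nonempty
  · obtain ⟨X, hX, hXQ⟩ := h
    obtain ⟨s, hs0, hs1, rfl⟩ := mem_segment_iff_exists.1 hX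
    rcases lt_trichotomy s t with h | rfl | h
    · rw [segmentElement_of_lt hs0 h ht1 hXQ ht,
        crossingElement_initial_of_mem hA ht1 hs0 h.le hXQ, crossingElement_final_eq_one ht1,
        mul_one]
      intro r hr _ hr'
      exact Set.disjoint_left.1 hd ht (mem_of_convex_of_le (convex_ray _ _) hXQ hr' h.le hr)
    · exact absurd hXQ (Set.disjoint_left.1 hd ht)
    · rw [segmentElement_of_gt hd h hXQ ht,
        crossingElement_final_of_mem hB ht0 hs1 h.le hXQ, crossingElement_initial_eq_one ht0,
        one_mul]
      intro r _ hr hr'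
      exact Set.disjoint_left.1 hd ht (mem_of_convex_of_le (convex_ray _ _) hr' hXQ hr h.le)
  · rw [segmentElement_of_not_meet_right h, crossingElement_initial_eq_one ht0,
      crossingElement_final_eq_one ht1, one_mul, mul_one]
    · exact fun r h0 h1 hr => h ⟨_, mem_segment_iff_exists.2 ⟨r, by linarith, h1, rfl⟩, hr⟩
    · exact fun r h0 h1 hr => h ⟨_, mem_segment_iff_exists.2 ⟨r, h0, by linarith, rfl⟩, hr⟩

end Splitting

/-! ### Products along paths and gauge changes -/

section PathProd

variable {G : Type*} [Group G]

/-- The product of a two-point function along a path given by its vertices. -/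
def pathProd (f : Plane → Plane → G) : List Plane → G
  | [] => 1
  | [_] => 1
  | A :: B :: L => f A B * pathProd f (B :: L)

/-- The product of a two-point function along a closed path. -/
def loopProd (f : Plane → Plane → G) : List Plane → G
  | [] => 1
  | A :: L => pathProd f (A :: (L ++ [A]))

theorem pathProd_append (f : Plane → Plane → G) (L : List Plane) (A : Plane) (M : List Plane) :
    pathProd f (L ++ A :: M) = pathProd f (L ++ [A]) * pathProd f (A :: M) := by
  induction L with
  | nil => simp [pathProd]
  | cons B L ih =>
    cases L with
    | nil => simp [pathProd]
    | cons C L => simpa [pathProd, mul_assoc] using ih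

theorem pathProd_gauge {f f' : Plane → Plane → G} (g : Plane → G) {r : Plane → Plane → Prop}
    {A B : Plane} {L : List Plane} (hL : (A :: (L ++ [B])).IsChain r)
    (h : ∀ X Y, X ∈ A :: (L ++ [B]) → Y ∈ A :: (L ++ [B]) → r X Y →
      f' X Y = (g X)⁻¹ * f X Y * g Y) :
    pathProd f' (A :: (L ++ [B])) = (g A)⁻¹ * pathProd f (A :: (L ++ [B])) * g B := by
  induction L generalizing A with
  | nil =>
    simp only [List.nil_append, List.isChain_cons_cons] at hL
    simpa [pathProd] using h A B (by simp) (by simp) hL.1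
  | cons C L ih =>
    simp only [List.cons_append] at hL h ⊢
    rw [List.isChain_cons_cons] at hL
    rw [pathProd, pathProd, h A C (by simp) (by simp) hL.1,
      ih hL.2 fun X Y hX hY => h X Y (List.mem_cons_of_mem _ hX) (List.mem_cons_of_mem _ hY)]
    group

/-- The factors g telescope, and on a closed path only conjugation by g at the starting vertex
survives. -/
theorem isConj_loopProd_of_gauge {f f' : Plane → Plane → G} (g : Plane → G)
    {r : Plane → Plane → Prop} {L : List Plane} (hL : Cycle.Chain r (L : Cycle Plane))
    (h : ∀ X Y, X ∈ L → Y ∈ L → r X Y → f' X Y = (g X)⁻¹ * f X Y * g Y) :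
    IsConj (loopProd f L) (loopProd f' L) := by
  cases L with
  | nil => exact IsConj.refl _
  | cons A L =>
    rw [Cycle.chain_coe_cons] at hL
    rw [loopProd, loopProd, pathProd_gauge g hL fun X Y hX hY => h X Y (by simp at hX ⊢; tauto)
      (by simp at hY ⊢; tauto)]
    exact isConj_iff.2 ⟨(g A)⁻¹, by group⟩

theorem isConj_loopProd_of_isRotated (f : Plane → Plane → G) {L M : List Plane} (h : L ~r M) :
    IsConj (loopProd f L) (loopProd f M) := by
  obtain ⟨s, t, rfl, rfl⟩ := exists_append_of_isRotated h
  rcases s with _ | ⟨A, s⟩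
  · rw [List.nil_append, List.append_nil]
  rcases t with _ | ⟨B, t⟩
  · rw [List.nil_append, List.append_nil]
  have e (A B : Plane) (s t : List Plane) : loopProd f (A :: s ++ B :: t) =
      pathProd f (A :: s ++ [B]) * pathProd f (B :: t ++ [A]) := by
    rw [List.cons_append, loopProd, List.append_assoc]
    exact pathProd_append f (A :: s) B (t ++ [A])
  rw [e, e]
  exact isConj_mul_comm _ _

end PathProd

theorem mk_listWord (P P' Q Q' : Plane) (L : List Plane) :
    FreeGroup.mk (listWord P P' Q Q' L) = loopProd (segmentElement P P' Q Q') L := by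
  cases L with
  | nil => rfl
  | cons A L =>
    -- The final vertex C is separated from the first vertex A so that the induction on the list can
    -- move A.
    have key : ∀ (C A : Plane) (L : List Plane), FreeGroup.mk
        (List.zipWith (segmentWord P P' Q Q') (A :: L) (L ++ [C])).flatten =
          pathProd (segmentElement P P' Q Q') (A :: (L ++ [C])) := by
      intro C A L
      induction L generalizing A with
      | nil => simp [pathProd, segmentElement]
      | cons B L ih =>
        simp only [List.cons_append, List.zipWith_cons_cons, List.flatten_cons, pathProd] at ih ⊢
        rw [← FreeGroup.mul_mk, ih, segmentElement]
    rw [listWord, loopProd, ← key]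
    simp

/-! ### Independence of the rays, one ray at a time -/

theorem isConj_of_change_left {P P' P'' Q Q' : Plane} {L : List Plane}
    (hL : Cycle.Chain (fun A B => segment ℝ A B ⊆ planeMinus P Q) (L : Cycle Plane))
    (hP' : P' ≠ P) (hP'' : P'' ≠ P)
    (hd' : Disjoint (ray P P') (ray Q Q')) (hd'' : Disjoint (ray P P'') (ray Q Q'))
    (h' : ∀ A ∈ L, A ∉ ray P P') (h'' : ∀ A ∈ L, A ∉ ray P P'') :
    IsConj (loopProd (segmentElement P P' Q Q') L) (loopProd (segmentElement P P'' Q Q') L) := by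
  obtain ⟨G, hG⟩ := exists_gauge .a hP' hP''
  have nP' : ∀ X ∈ ray Q Q', X ∉ ray P P' := Set.disjoint_right.1 hd'
  have nP'' : ∀ X ∈ ray Q Q', X ∉ ray P P'' := Set.disjoint_right.1 hd''
  have hconst : ∀ X ∈ ray Q Q', G X = G Q := by
    intro X hX
    have hsub := (convex_ray Q Q').segment_subset hX (origin_mem_ray Q Q')
    have hQ := origin_mem_ray Q Q'
    refine (hG X Q (nP' X hX) (nP'' X hX) (nP' Q hQ) (nP'' Q hQ)
      fun h => nP' P (hsub h) (origin_mem_ray _ _)).2 ?_ ?_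
    · rintro ⟨Y, hY, hY'⟩; exact nP' Y (hsub hY) hY'
    · rintro ⟨Y, hY, hY'⟩; exact nP'' Y (hsub hY) hY'
  -- Subtracting the constant value on the ray from Q makes the gauge trivial there, so the letter b
  -- at a crossing with that ray is not conjugated. On the remaining pieces everything is a power of
  -- a and commutes.
  refine isConj_loopProd_of_gauge (fun A => FreeGroup.of Gen.a ^ (G A - G Q)) hL ?_
  intro A B hA hB hAB
  have hPAB : P ∉ segment ℝ A B := fun h => (hAB h).1 rfl
  by_cases hX : (segment ℝ A B ∩ ray Q Q').Nonempty
  · obtain ⟨X, hX, hXQ⟩ := hX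
    have hAX : segment ℝ A X ⊆ segment ℝ A B :=
      (convex_segment A B).segment_subset (left_mem_segment ℝ A B) hX
    have hXB : segment ℝ X B ⊆ segment ℝ A B :=
      (convex_segment A B).segment_subset hX (right_mem_segment ℝ A B)
    have hGX := hconst X hXQ
    have e1 := (hG A X (h' A hA) (h'' A hA) (nP' X hXQ) (nP'' X hXQ) fun h => hPAB (hAX h)).1
    have e2 := (hG X B (nP' X hXQ) (nP'' X hXQ) (h' B hB) (h'' B hB) fun h => hPAB (hXB h)).1
    obtain ⟨s, hs0, hs1, rfl⟩ := mem_segment_iff_exists.1 hX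
    rw [segmentElement_split_right hd' (h' A hA) (h' B hB) hs0 hs1 hXQ,
      segmentElement_split_right hd'' (h'' A hA) (h'' B hB) hs0 hs1 hXQ, e1, e2, hGX]
    obtain ⟨m, hm⟩ := exists_crossingElement_eq_zpow .a P P' A (A + s • (B - A))
    obtain ⟨n, hn⟩ := exists_crossingElement_eq_zpow .a P P' (A + s • (B - A)) B
    rw [hm, hn]
    group
  · rw [segmentElement_of_not_meet_right hX, segmentElement_of_not_meet_right hX,
      (hG A B (h' A hA) (h'' A hA) (h' B hB) (h'' B hB) hPAB).1,
      crossingElement_eq .a hP' (h' A hA) (h' B hB) hPAB]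
    group

theorem isConj_of_change_right {P P' Q Q' Q'' : Plane} {L : List Plane}
    (hL : Cycle.Chain (fun A B => segment ℝ A B ⊆ planeMinus P Q) (L : Cycle Plane))
    (hQ' : Q' ≠ Q) (hQ'' : Q'' ≠ Q)
    (hd' : Disjoint (ray P P') (ray Q Q')) (hd'' : Disjoint (ray P P') (ray Q Q''))
    (h' : ∀ A ∈ L, A ∉ ray Q Q') (h'' : ∀ A ∈ L, A ∉ ray Q Q'') :
    IsConj (loopProd (segmentElement P P' Q Q') L) (loopProd (segmentElement P P' Q Q'') L) := by
  obtain ⟨G, hG⟩ := exists_gauge .b hQ' hQ''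
  have nQ' : ∀ X ∈ ray P P', X ∉ ray Q Q' := Set.disjoint_left.1 hd'
  have nQ'' : ∀ X ∈ ray P P', X ∉ ray Q Q'' := Set.disjoint_left.1 hd''
  have hconst : ∀ X ∈ ray P P', G X = G P := by
    intro X hX
    have hsub := (convex_ray P P').segment_subset hX (origin_mem_ray P P')
    have hP := origin_mem_ray P P'
    refine (hG X P (nQ' X hX) (nQ'' X hX) (nQ' P hP) (nQ'' P hP)
      fun h => nQ' Q (hsub h) (origin_mem_ray _ _)).2 ?_ ?_
    · rintro ⟨Y, hY, hY'⟩; exact nQ' Y (hsub hY) hY'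
    · rintro ⟨Y, hY, hY'⟩; exact nQ'' Y (hsub hY) hY'
  refine isConj_loopProd_of_gauge (fun A => FreeGroup.of Gen.b ^ (G A - G P)) hL ?_
  intro A B hA hB hAB
  have hQAB : Q ∉ segment ℝ A B := fun h => (hAB h).2 rfl
  by_cases hX : (segment ℝ A B ∩ ray P P').Nonempty
  · obtain ⟨X, hX, hXP⟩ := hX
    have hAX : segment ℝ A X ⊆ segment ℝ A B :=
      (convex_segment A B).segment_subset (left_mem_segment ℝ A B) hX
    have hXB : segment ℝ X B ⊆ segment ℝ A B :=
      (convex_segment A B).segment_subset hX (right_mem_segment ℝ A B)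
    have hGX := hconst X hXP
    have e1 := (hG A X (h' A hA) (h'' A hA) (nQ' X hXP) (nQ'' X hXP) fun h => hQAB (hAX h)).1
    have e2 := (hG X B (nQ' X hXP) (nQ'' X hXP) (h' B hB) (h'' B hB) fun h => hQAB (hXB h)).1
    obtain ⟨s, hs0, hs1, rfl⟩ := mem_segment_iff_exists.1 hX
    rw [segmentElement_split_left hd' (h' A hA) (h' B hB) hs0 hs1 hXP,
      segmentElement_split_left hd'' (h'' A hA) (h'' B hB) hs0 hs1 hXP, e1, e2, hGX]
    obtain ⟨m, hm⟩ := exists_crossingElement_eq_zpow .b Q Q' A (A + s • (B - A))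
    obtain ⟨n, hn⟩ := exists_crossingElement_eq_zpow .b Q Q' (A + s • (B - A)) B
    rw [hm, hn]
    group
  · rw [segmentElement_of_not_meet_left hX, segmentElement_of_not_meet_left hX,
      (hG A B (h' A hA) (h'' A hA) (h' B hB) (h'' B hB) hQAB).1,
      crossingElement_eq .b hQ' (h' A hA) (h' B hB) hQAB]
    group

/-! ### Crossings with the line PQ -/

/-- The parameter τ of the crossing point tells in which part of the line PQ it lies; the two
identities turn the conditions τ < 0 and τ > 1 into signs of `orient A B P` and `orient A B Q`. -/
theorem exists_mem_segment_line {P Q A B : Plane} (hPQ : P ≠ Q) (hA : 0 ≤ orient P Q A)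
    (hB : orient P Q B < 0) :
    ∃ τ : ℝ, P + τ • (Q - P) ∈ segment ℝ A B ∧
      orient A B P = τ * (orient P Q B - orient P Q A) ∧
      orient A B Q = (τ - 1) * (orient P Q B - orient P Q A) := by
  have hne : orient P Q A - orient P Q B ≠ 0 := by linarith
  obtain ⟨s, hs⟩ : ∃ s, s = orient P Q A / (orient P Q A - orient P Q B) := ⟨_, rfl⟩
  have hs' : s * (orient P Q A - orient P Q B) = orient P Q A := by
    rw [hs, div_mul_cancel₀ _ hne]
  have hX : A + s • (B - A) ∈ segment ℝ A B := by
    refine mem_segment_iff_exists.2 ⟨s, ?_, ?_, rfl⟩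
    · rw [hs]; exact div_nonneg hA (by linarith)
    · rw [hs, div_le_one (by linarith)]; linarith
  have h0 : det2 (Q - P) (A + s • (B - A) - P) = 0 := by
    simp only [orient, det2, Prod.fst_add, Prod.snd_add, Prod.smul_fst, Prod.smul_snd, smul_eq_mul,
      Prod.fst_sub, Prod.snd_sub] at hs' ⊢
    linear_combination -hs'
  obtain ⟨τ, hτ⟩ := exists_smul_of_det2_eq_zero (sub_ne_zero.2 hPQ.symm) h0
  have hτ' : P + τ • (Q - P) = A + s • (B - A) := by rw [← hτ]; abel
  refine ⟨τ, hτ' ▸ hX, ?_, ?_⟩ <;>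
  · have e1 := congrArg Prod.fst hτ'
    have e2 := congrArg Prod.snd hτ'
    simp only [Prod.fst_add, Prod.snd_add, Prod.smul_fst, Prod.smul_snd, smul_eq_mul,
      Prod.fst_sub, Prod.snd_sub] at e1 e2
    simp only [orient]
    linear_combination (B.1 - A.1) * e2 - (B.2 - A.2) * e1

open Classical in
/-- The generator written when the line `PQ` is crossed from the left side of `PQ` to the right
side along the segment from `A` to `B`. -/
noncomputable def downElement (P Q A B : Plane) : FreeGroup Gen :=
  if 0 < orient A B P then (FreeGroup.of .a)⁻¹ else
    if orient A B Q < 0 then FreeGroup.of .b else 1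

open Classical in
/-- The element of the free group given by the crossings of the segment from `A` to `B` with the
two parts of the line `PQ` outside the segment `PQ`, where points on the line count as
points to the left of it. -/
noncomputable def lineElement (P Q A B : Plane) : FreeGroup Gen :=
  if 0 ≤ orient P Q A then
    if 0 ≤ orient P Q B then 1 else downElement P Q A B
  else
    if 0 ≤ orient P Q B then (downElement P Q B A)⁻¹ else 1

/-- Two crossing points in a convex set that misses P and Q cannot be separated on the line by P or
by Q. -/
theorem downElement_eq_of_convex {P Q A B A' B' : Plane} (hPQ : P ≠ Q) {S : Set Plane}
    (hS : Convex ℝ S) (hSN : S ⊆ planeMinus P Q) (hA : A ∈ S) (hB : B ∈ S) (hA' : A' ∈ S)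
    (hB' : B' ∈ S) (yA : 0 ≤ orient P Q A) (yB : orient P Q B < 0) (yA' : 0 ≤ orient P Q A')
    (yB' : orient P Q B' < 0) : downElement P Q A B = downElement P Q A' B' := by
  obtain ⟨τ, h1, h2, h3⟩ := exists_mem_segment_line hPQ yA yB
  obtain ⟨τ', h1', h2', h3'⟩ := exists_mem_segment_line hPQ yA' yB'
  have hX := hS.segment_subset hA hB h1
  have hX' := hS.segment_subset hA' hB' h1'
  have hP : ∀ r t : ℝ, P + r • (Q - P) ∈ S → P + t • (Q - P) ∈ S → r ≤ 0 → 0 ≤ t → False := by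
    intro r t hr ht h h'
    have := hSN (mem_of_convex_of_le hS hr ht h h')
    exact this.1 (by simp)
  have hQ : ∀ r t : ℝ, P + r • (Q - P) ∈ S → P + t • (Q - P) ∈ S → r ≤ 1 → 1 ≤ t → False := by
    intro r t hr ht h h'
    have := hSN (mem_of_convex_of_le hS hr ht h h')
    exact this.2 (by simp)
  have e : ∀ x c : ℝ, c < 0 → (0 < x * c ↔ x < 0) := fun x c hc => by rw [mul_pos_iff]; grind
  have e' : ∀ x c : ℝ, c < 0 → (x * c < 0 ↔ 0 < x) := fun x c hc => by rw [mul_neg_iff]; grind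
  have i1 : 0 < orient A B P ↔ 0 < orient A' B' P := by
    rw [h2, h2', e _ _ (by linarith), e _ _ (by linarith)]
    constructor <;> intro h <;> by_contra! h'
    · exact hP _ _ hX hX' h.le h'
    · exact hP _ _ hX' hX h.le h'
  have i2 : orient A B Q < 0 ↔ orient A' B' Q < 0 := by
    rw [h3, h3', e' _ _ (by linarith), e' _ _ (by linarith)]
    constructor <;> intro h <;> by_contra! h'
    · exact hQ _ _ hX' hX (by linarith) (by linarith)
    · exact hQ _ _ hX hX' (by linarith) (by linarith)
  unfold downElement
  simp only [i1, i2]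

/-- By `downElement_eq_of_convex` all downward crossings inside the triangle carry the same element,
so in each distribution of the vertices over the two sides the factors cancel or agree. -/
theorem lineElement_mul {P Q A B C : Plane} (hPQ : P ≠ Q)
    (h : convexHull ℝ {A, B, C} ⊆ planeMinus P Q) :
    lineElement P Q A B * lineElement P Q B C = lineElement P Q A C := by
  have hA : A ∈ convexHull ℝ {A, B, C} := subset_convexHull _ _ (by simp)
  have hB : B ∈ convexHull ℝ {A, B, C} := subset_convexHull _ _ (by simp)
  have hC : C ∈ convexHull ℝ {A, B, C} := subset_convexHull _ _ (by simp)
  have key := fun {X Y X' Y' : Plane} =>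
    downElement_eq_of_convex (A := X) (B := Y) (A' := X') (B' := Y') hPQ (convex_convexHull ℝ _) h
  unfold lineElement
  split_ifs with a b c c b c c
  · simp
  · rw [one_mul, key hB hC hA hC b (not_le.1 c) a (not_le.1 c)]
  · rw [key hA hB hC hB a (not_le.1 b) c (not_le.1 b), mul_inv_cancel]
  · rw [mul_one, key hA hB hA hC a (not_le.1 b) a (not_le.1 c)]
  · rw [mul_one, key hB hA hC hA b (not_le.1 a) c (not_le.1 a)]
  · rw [key hB hA hB hC b (not_le.1 a) b (not_le.1 c), inv_mul_cancel]
  · rw [one_mul, key hC hB hC hA c (not_le.1 b) c (not_le.1 a)]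
  · simp

/-! ### Rays slightly turned away from the line PQ -/

theorem not_mem_ray_of_det2_ne_zero {O R A : Plane} (h : det2 (R - O) (A - O) ≠ 0) :
    A ∉ ray O R := by
  rintro ⟨t, -, rfl⟩
  rw [add_sub_cancel_left, det2_smul_right, det2_self, mul_zero] at h
  exact h rfl

/-- A ray from `P`, slightly turned from the direction opposite to `Q`. -/
noncomputable def leftEnd (P Q : Plane) (ε : ℝ) : Plane :=
  P - (Q - P) - ε • (-(Q - P).2, (Q - P).1)

/-- A ray from `Q`, slightly turned from the direction opposite to `P`. -/
noncomputable def rightEnd (P Q : Plane) (ε : ℝ) : Plane :=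
  Q + (Q - P) - ε • (-(Q - P).2, (Q - P).1)

/-- The scalar product of two plane vectors. -/
def dot2 (v w : Plane) : ℝ := v.1 * w.1 + v.2 * w.2

theorem dot2_self_pos {v : Plane} (h : v ≠ 0) : 0 < dot2 v v := by
  unfold dot2
  rcases eq_or_ne v.1 0 with h1 | h1
  · have h2 : v.2 ≠ 0 := fun h2 => h (Prod.ext h1 h2)
    have := mul_self_pos.2 h2
    nlinarith [mul_self_nonneg v.1]
  · have := mul_self_pos.2 h1
    nlinarith [mul_self_nonneg v.2]

theorem det2_leftEnd (P Q A : Plane) (ε : ℝ) :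
    det2 (leftEnd P Q ε - P) (A - P) = -orient P Q A + ε * dot2 (Q - P) (A - P) := by
  simp only [leftEnd, det2, dot2, orient, Prod.fst_sub, Prod.snd_sub, Prod.smul_fst, Prod.smul_snd,
    smul_eq_mul]
  ring

theorem det2_rightEnd (P Q A : Plane) (ε : ℝ) :
    det2 (rightEnd P Q ε - Q) (A - Q) = orient P Q A + ε * dot2 (Q - P) (A - Q) := by
  simp only [rightEnd, det2, dot2, orient, Prod.fst_sub, Prod.snd_sub, Prod.smul_fst,
    Prod.smul_snd, Prod.fst_add, Prod.snd_add, smul_eq_mul]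
  ring

/-- The determinants of a turned ray have the form y + εx: for small ε > 0 the sign is that of y,
and x decides when y = 0. -/
theorem eventually_sign (y x : ℝ) : ∀ᶠ ε : ℝ in 𝓝[>] 0,
    (0 < y → 0 < y + ε * x) ∧ (y < 0 → y + ε * x < 0) ∧
      (y = 0 → 0 < x → 0 < y + ε * x) ∧ (y = 0 → x < 0 → y + ε * x < 0) := by
  have ht : Tendsto (fun ε : ℝ => y + ε * x) (𝓝[>] 0) (𝓝 y) := by
    have : Continuous fun ε : ℝ => y + ε * x := by fun_prop
    have := this.tendsto 0
    simp only [zero_mul, add_zero] at this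
    exact this.mono_left nhdsWithin_le_nhds
  have h1 : ∀ᶠ ε : ℝ in 𝓝[>] 0, 0 < y → 0 < y + ε * x := by
    by_cases h : 0 < y
    · filter_upwards [ht.eventually (lt_mem_nhds h)] with ε hε _ using hε
    · simp [h]
  have h2 : ∀ᶠ ε : ℝ in 𝓝[>] 0, y < 0 → y + ε * x < 0 := by
    by_cases h : y < 0
    · filter_upwards [ht.eventually (gt_mem_nhds h)] with ε hε _ using hε
    · simp [h]
  filter_upwards [h1, h2, self_mem_nhdsWithin] with ε k1 k2 (hε : 0 < ε)
  refine ⟨k1, k2, fun h hx => ?_, fun h hx => ?_⟩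
  · rw [h, zero_add]; positivity
  · rw [h, zero_add]; exact mul_neg_of_pos_of_neg hε hx

/-- The sign conditions satisfied by the rays ending in `leftEnd` and `rightEnd` for small `ε`. -/
structure SmallFor (P Q : Plane) (ε : ℝ) (A : Plane) : Prop where
  left_pos : 0 < orient P Q A → det2 (leftEnd P Q ε - P) (A - P) < 0
  left_neg : orient P Q A < 0 → 0 < det2 (leftEnd P Q ε - P) (A - P)
  left_zero_pos : orient P Q A = 0 → 0 < dot2 (Q - P) (A - P) →
    0 < det2 (leftEnd P Q ε - P) (A - P)
  left_zero_neg : orient P Q A = 0 → dot2 (Q - P) (A - P) < 0 →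
    det2 (leftEnd P Q ε - P) (A - P) < 0
  right_pos : 0 < orient P Q A → 0 < det2 (rightEnd P Q ε - Q) (A - Q)
  right_neg : orient P Q A < 0 → det2 (rightEnd P Q ε - Q) (A - Q) < 0
  right_zero_pos : orient P Q A = 0 → 0 < dot2 (Q - P) (A - Q) →
    0 < det2 (rightEnd P Q ε - Q) (A - Q)
  right_zero_neg : orient P Q A = 0 → dot2 (Q - P) (A - Q) < 0 →
    det2 (rightEnd P Q ε - Q) (A - Q) < 0

theorem eventually_smallFor (P Q A : Plane) : ∀ᶠ ε : ℝ in 𝓝[>] 0, SmallFor P Q ε A := by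
  filter_upwards [eventually_sign (-orient P Q A) (dot2 (Q - P) (A - P)),
    eventually_sign (orient P Q A) (dot2 (Q - P) (A - Q))] with ε h h'
  rw [← det2_leftEnd] at h
  rw [← det2_rightEnd] at h'
  exact ⟨fun k => h.2.1 (by linarith), fun k => h.1 (by linarith),
    fun k => h.2.2.1 (by linarith), fun k => h.2.2.2 (by linarith),
    h'.1, h'.2.1, h'.2.2.1, h'.2.2.2⟩

theorem dot2_ne_zero {P Q A O : Plane} (hPQ : P ≠ Q) (hO : orient P Q O = 0) (hA : A ≠ O)
    (h : orient P Q A = 0) : dot2 (Q - P) (A - O) ≠ 0 := by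
  intro h'
  have hn := dot2_self_pos (sub_ne_zero.2 hPQ.symm)
  refine hA (sub_eq_zero.1 ?_)
  have h1 : dot2 (Q - P) (Q - P) * (A - O).1 = 0 := by
    simp only [dot2, orient, Prod.fst_sub, Prod.snd_sub] at *
    linear_combination (Q.1 - P.1) * h' - (Q.2 - P.2) * (h - hO)
  have h2 : dot2 (Q - P) (Q - P) * (A - O).2 = 0 := by
    simp only [dot2, orient, Prod.fst_sub, Prod.snd_sub] at *
    linear_combination (Q.2 - P.2) * h' + (Q.1 - P.1) * (h - hO)
  exact Prod.ext ((mul_eq_zero.1 h1).resolve_left hn.ne')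
    ((mul_eq_zero.1 h2).resolve_left hn.ne')

theorem orient_self_left (P Q : Plane) : orient P Q P = 0 := by simp [orient]
theorem orient_self_right (P Q : Plane) : orient P Q Q = 0 := by simp only [orient]; ring

section Small

variable {P Q A B : Plane} {ε : ℝ}

theorem SmallFor.not_mem_left (h : SmallFor P Q ε A) (hPQ : P ≠ Q) (hA : A ≠ P) :
    A ∉ ray P (leftEnd P Q ε) := by
  refine not_mem_ray_of_det2_ne_zero ?_
  rcases lt_trichotomy (orient P Q A) 0 with k | k | k
  · exact (h.left_neg k).ne'
  · rcases lt_or_gt_of_ne (dot2_ne_zero hPQ (orient_self_left P Q) hA k) with k' | k'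
    · exact (h.left_zero_neg k k').ne
    · exact (h.left_zero_pos k k').ne'
  · exact (h.left_pos k).ne

theorem SmallFor.not_mem_right (h : SmallFor P Q ε A) (hPQ : P ≠ Q) (hA : A ≠ Q) :
    A ∉ ray Q (rightEnd P Q ε) := by
  refine not_mem_ray_of_det2_ne_zero ?_
  rcases lt_trichotomy (orient P Q A) 0 with k | k | k
  · exact (h.right_neg k).ne
  · rcases lt_or_gt_of_ne (dot2_ne_zero hPQ (orient_self_right P Q) hA k) with k' | k'
    · exact (h.right_zero_neg k k').ne
    · exact (h.right_zero_pos k k').ne'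
  · exact (h.right_pos k).ne'

theorem leftEnd_ne (hPQ : P ≠ Q) : leftEnd P Q ε ≠ P := by
  intro h
  -- Against the normal of PQ the determinant is -|Q - P|², whatever ε is.
  have h2 := det2_leftEnd P Q (P + (-(Q - P).2, (Q - P).1)) ε
  have hn := dot2_self_pos (sub_ne_zero.2 hPQ.symm)
  rw [h] at h2
  simp only [det2, dot2, orient, Prod.fst_sub, Prod.snd_sub, Prod.fst_add, Prod.snd_add] at h2 hn
  nlinarith

theorem rightEnd_ne (hPQ : P ≠ Q) : rightEnd P Q ε ≠ Q := by
  intro h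
  have h2 := det2_rightEnd P Q (Q + (-(Q - P).2, (Q - P).1)) ε
  have hn := dot2_self_pos (sub_ne_zero.2 hPQ.symm)
  rw [h] at h2
  simp only [det2, dot2, orient, Prod.fst_sub, Prod.snd_sub, Prod.fst_add, Prod.snd_add] at h2 hn
  nlinarith

theorem disjoint_left_right (hPQ : P ≠ Q) :
    Disjoint (ray P (leftEnd P Q ε)) (ray Q (rightEnd P Q ε)) := by
  rw [Set.disjoint_left]
  rintro X ⟨s, hs, rfl⟩ ⟨t, ht, h⟩
  have hn := dot2_self_pos (sub_ne_zero.2 hPQ.symm)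
  have e1 := congrArg Prod.fst h
  have e2 := congrArg Prod.snd h
  simp only [leftEnd, rightEnd, dot2, Prod.fst_add, Prod.snd_add, Prod.smul_fst, Prod.smul_snd,
    smul_eq_mul, Prod.fst_sub, Prod.snd_sub] at e1 e2 hn
  set n := (Q.1 - P.1) * (Q.1 - P.1) + (Q.2 - P.2) * (Q.2 - P.2)
  -- Scalar product with Q - P: the left ray stays at or behind P, the right one at or beyond Q.
  have h1 : (s + t + 1) * n = 0 := by
    linear_combination -(Q.1 - P.1) * e1 - (Q.2 - P.2) * e2
  have := (mul_eq_zero.1 h1).resolve_right hn.ne'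
  linarith

theorem eventually_disjoint_right {P' : Plane} (hPQ : P ≠ Q) (hP' : P' ≠ P)
    (hQ : Q ∉ ray P P') :
    ∀ᶠ ε : ℝ in 𝓝[>] 0, Disjoint (ray P P') (ray Q (rightEnd P Q ε)) := by
  have hn := dot2_self_pos (sub_ne_zero.2 hPQ.symm)
  -- Determinant of a common point with P' - P. The left side of the equation equals d + t(d + ε ·
  -- dot) with d = det2 (P' - P) (Q - P), which for small ε has the sign of d if d ≠ 0.
  have key : ∀ ε, ¬ Disjoint (ray P P') (ray Q (rightEnd P Q ε)) → ∃ t, 0 ≤ t ∧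
      (1 + t) * det2 (P' - P) (Q - P) + t * ε * dot2 (P' - P) (P - Q) = 0 := by
    intro ε h
    obtain ⟨X, ⟨s, hs, rfl⟩, ⟨t, ht, h⟩⟩ := Set.not_disjoint_iff.1 h
    have e1 := congrArg Prod.fst h
    have e2 := congrArg Prod.snd h
    refine ⟨t, ht, ?_⟩
    simp only [rightEnd, dot2, det2, Prod.fst_add, Prod.snd_add, Prod.smul_fst, Prod.smul_snd,
      smul_eq_mul, Prod.fst_sub, Prod.snd_sub] at e1 e2 ⊢
    linear_combination (P'.2 - P.2) * e1 - (P'.1 - P.1) * e2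
  by_cases h0 : det2 (P' - P) (Q - P) = 0
  -- The ray from P lies on the line PQ and avoids Q, so it points away from Q, and projection to PQ
  -- separates the rays.
  · filter_upwards [self_mem_nhdsWithin] with ε (hε : 0 < ε)
    by_contra hd
    obtain ⟨r, hr⟩ := exists_smul_of_det2_eq_zero (sub_ne_zero.2 hP') h0
    have hr0 : r < 0 := by
      by_contra! h
      exact hQ (mem_ray_of_sub_eq h hr)
    obtain ⟨X, ⟨s, hs, rfl⟩, ⟨t, ht, h⟩⟩ := Set.not_disjoint_iff.1 hd
    have e1 := congrArg Prod.fst h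
    have e2 := congrArg Prod.snd h
    have r1 := congrArg Prod.fst hr
    have r2 := congrArg Prod.snd hr
    simp only [rightEnd, dot2, Prod.fst_add, Prod.snd_add, Prod.smul_fst, Prod.smul_snd,
      smul_eq_mul, Prod.fst_sub, Prod.snd_sub] at e1 e2 hn r1 r2
    set n := (Q.1 - P.1) * (Q.1 - P.1) + (Q.2 - P.2) * (Q.2 - P.2)
    have h1 : (s - r * (1 + t)) * n = 0 := by
      linear_combination r * (Q.1 - P.1) * e1 + r * (Q.2 - P.2) * e2 + s * (Q.1 - P.1) * r1
        + s * (Q.2 - P.2) * r2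
    have := (mul_eq_zero.1 h1).resolve_right hn.ne'
    nlinarith
  · filter_upwards [eventually_sign (det2 (P' - P) (Q - P)) (dot2 (P' - P) (P - Q)),
      self_mem_nhdsWithin] with ε h _
    by_contra hd
    obtain ⟨t, ht, h'⟩ := key ε hd
    rcases lt_or_gt_of_ne h0 with k | k
    · nlinarith [h.2.1 k]
    · nlinarith [h.1 k]

theorem orient_frame (P Q A B : Plane) : dot2 (Q - P) (Q - P) * orient A B P =
    dot2 (Q - P) (A - P) * orient P Q B - dot2 (Q - P) (B - P) * orient P Q A := by
  simp only [dot2, orient, Prod.fst_sub, Prod.snd_sub]; ring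

theorem orient_frame' (P Q A B : Plane) : dot2 (Q - P) (Q - P) * orient A B Q =
    dot2 (Q - P) (A - Q) * orient P Q B - dot2 (Q - P) (B - Q) * orient P Q A := by
  simp only [dot2, orient, Prod.fst_sub, Prod.snd_sub]; ring

/-- The numbers x and y are coordinates along and across PQ, and p, q are the perturbed y with ties
broken by x. Only an end point with y = 0 and x < 0 could violate the convention that y = 0 counts
as the left side; if the other end has y < 0, the formula for δ excludes a crossing on both sides of
the equivalence. -/
theorem crossing_iff_of_signs {n yA yB xA xB δ p q : ℝ} (hn : 0 < n)
    (h : n * δ = xA * yB - xB * yA)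
    (hA : yA = 0 → xA ≠ 0) (hB : yB = 0 → xB ≠ 0)
    (a1 : 0 < yA → 0 < p) (a2 : yA < 0 → p < 0) (a3 : yA = 0 → 0 < xA → 0 < p)
    (a4 : yA = 0 → xA < 0 → p < 0)
    (b1 : 0 < yB → 0 < q) (b2 : yB < 0 → q < 0) (b3 : yB = 0 → 0 < xB → 0 < q)
    (b4 : yB = 0 → xB < 0 → q < 0) :
    ((0 < p ∧ q < 0 ∧ δ < 0) ↔ (0 ≤ yA ∧ yB < 0 ∧ δ < 0)) ∧
      ((p < 0 ∧ 0 < q ∧ 0 < δ) ↔ (yA < 0 ∧ 0 ≤ yB ∧ 0 < δ)) := by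
  have hδ : δ < 0 ↔ xA * yB - xB * yA < 0 := by rw [← h, mul_neg_iff]; grind
  have hδ' : 0 < δ ↔ 0 < xA * yB - xB * yA := by rw [← h, mul_pos_iff]; grind
  rw [hδ, hδ']
  rcases lt_trichotomy yA 0 with k | k | k <;> rcases lt_trichotomy yB 0 with k' | k' | k'
  · have := a2 k; have := b2 k'; grind
  · have := a2 k
    rcases lt_or_gt_of_ne (hB k') with l | l
    · have := b4 k' l
      have := mul_pos_of_neg_of_neg l k
      subst k'; grind
    · have := b3 k' l
      subst k'; grind
  · have := a2 k; have := b1 k'; grind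
  · have := b2 k'
    rcases lt_or_gt_of_ne (hA k) with l | l
    · have := a4 k l
      have := mul_pos_of_neg_of_neg l k'
      subst k; grind
    · have := a3 k l
      subst k; grind
  · subst k k'; simp
  · have := b1 k'
    rcases lt_or_gt_of_ne (hA k) with l | l
    · have := a4 k l
      have := mul_neg_of_neg_of_pos l k'
      subst k; grind
    · have := a3 k l
      subst k; grind
  · have := a1 k; have := b2 k'; grind
  · have := a1 k
    rcases lt_or_gt_of_ne (hB k') with l | l
    · have := b4 k' l
      have := mul_neg_of_neg_of_pos l k
      subst k'; grind
    · have := b3 k' l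
      subst k'; grind
  · have := a1 k; have := b1 k'; grind

theorem left_meets_iff (hPQ : P ≠ Q) (hA : SmallFor P Q ε A) (hB : SmallFor P Q ε B)
    (h : segment ℝ A B ⊆ planeMinus P Q) :
    (segment ℝ A B ∩ ray P (leftEnd P Q ε)).Nonempty ↔
      (0 ≤ orient P Q A ∧ orient P Q B < 0 ∧ 0 < orient A B P) ∨
      (orient P Q A < 0 ∧ 0 ≤ orient P Q B ∧ orient A B P < 0) := by
  have hAP : A ≠ P := (h (left_mem_segment ℝ A B)).1
  have hBP : B ≠ P := (h (right_mem_segment ℝ A B)).1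
  rw [segment_inter_ray_nonempty_iff (leftEnd_ne hPQ) (hA.not_mem_left hPQ hAP)
    (hB.not_mem_left hPQ hBP) fun k => (h k).1 rfl]
  -- The left ray points against Q - P, so x, δ and the determinants all enter with the opposite
  -- sign.
  have key := crossing_iff_of_signs (n := dot2 (Q - P) (Q - P)) (yA := orient P Q A)
    (yB := orient P Q B) (xA := -dot2 (Q - P) (A - P)) (xB := -dot2 (Q - P) (B - P))
    (δ := -orient A B P) (p := -det2 (leftEnd P Q ε - P) (A - P))
    (q := -det2 (leftEnd P Q ε - P) (B - P)) (dot2_self_pos (sub_ne_zero.2 hPQ.symm))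
    (by linarith [orient_frame P Q A B])
    (fun k => neg_ne_zero.2 (dot2_ne_zero hPQ (orient_self_left P Q) hAP k))
    (fun k => neg_ne_zero.2 (dot2_ne_zero hPQ (orient_self_left P Q) hBP k))
    (fun k => neg_pos.2 (hA.left_pos k)) (fun k => neg_neg_iff_pos.2 (hA.left_neg k))
    (fun k l => neg_pos.2 (hA.left_zero_neg k (neg_pos.1 l)))
    (fun k l => neg_neg_iff_pos.2 (hA.left_zero_pos k (neg_neg_iff_pos.1 l)))
    (fun k => neg_pos.2 (hB.left_pos k)) (fun k => neg_neg_iff_pos.2 (hB.left_neg k))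
    (fun k l => neg_pos.2 (hB.left_zero_neg k (neg_pos.1 l)))
    (fun k l => neg_neg_iff_pos.2 (hB.left_zero_pos k (neg_neg_iff_pos.1 l)))
  simp only [neg_pos, neg_neg_iff_pos] at key
  rw [← key.1, ← key.2]
  tauto

theorem right_meets_iff (hPQ : P ≠ Q) (hA : SmallFor P Q ε A) (hB : SmallFor P Q ε B)
    (h : segment ℝ A B ⊆ planeMinus P Q) :
    (segment ℝ A B ∩ ray Q (rightEnd P Q ε)).Nonempty ↔
      (0 ≤ orient P Q A ∧ orient P Q B < 0 ∧ orient A B Q < 0) ∨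
      (orient P Q A < 0 ∧ 0 ≤ orient P Q B ∧ 0 < orient A B Q) := by
  have hAQ : A ≠ Q := (h (left_mem_segment ℝ A B)).2
  have hBQ : B ≠ Q := (h (right_mem_segment ℝ A B)).2
  rw [segment_inter_ray_nonempty_iff (rightEnd_ne hPQ) (hA.not_mem_right hPQ hAQ)
    (hB.not_mem_right hPQ hBQ) fun k => (h k).2 rfl]
  have key := crossing_iff_of_signs (dot2_self_pos (sub_ne_zero.2 hPQ.symm))
    (orient_frame' P Q A B)
    (dot2_ne_zero hPQ (orient_self_right P Q) hAQ) (dot2_ne_zero hPQ (orient_self_right P Q) hBQ)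
    hA.right_pos hA.right_neg hA.right_zero_pos hA.right_zero_neg
    hB.right_pos hB.right_neg hB.right_zero_pos hB.right_zero_neg
  rw [← key.1, ← key.2]

theorem segmentElement_eq_lineElement (hPQ : P ≠ Q) (hA : SmallFor P Q ε A)
    (hB : SmallFor P Q ε B) (h : segment ℝ A B ⊆ planeMinus P Q) :
    segmentElement P (leftEnd P Q ε) Q (rightEnd P Q ε) A B = lineElement P Q A B := by
  have hl := left_meets_iff hPQ hA hB h
  have hr := right_meets_iff hPQ hA hB h
  have hδ : orient A B Q = orient A B P + (orient P Q A - orient P Q B) := by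
    simp only [orient]; ring
  have hP : orient B A P = - orient A B P := by simp only [orient]; ring
  have hQ : orient B A Q = - orient A B Q := by simp only [orient]; ring
  by_cases l : (segment ℝ A B ∩ ray P (leftEnd P Q ε)).Nonempty
  -- The segment crosses the line PQ at most once, so it cannot meet both rays; `hδ` expresses this
  -- in signs.
  · have nr : ¬ (segment ℝ A B ∩ ray Q (rightEnd P Q ε)).Nonempty := by
      intro r
      rw [hl] at l
      rw [hr] at r
      grind
    rw [segmentElement_of_not_meet_right nr, crossingElement_of_meet l]
    rcases hl.1 l with ⟨h1, h2, h3⟩ | ⟨h1, h2, h3⟩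
    · simp [lineElement, downElement, h1, not_le_of_gt h2, h3, not_lt_of_gt h3, FreeGroup.of,
        FreeGroup.inv_mk, FreeGroup.invRev]
    · simp [lineElement, downElement, not_le_of_gt h1, h2, hP, h3, FreeGroup.of]
  · rw [segmentElement_of_not_meet_left l]
    by_cases r : (segment ℝ A B ∩ ray Q (rightEnd P Q ε)).Nonempty
    · rw [crossingElement_of_meet r]
      rw [hl] at l
      rcases hr.1 r with ⟨h1, h2, h3⟩ | ⟨h1, h2, h3⟩
      · have : ¬ 0 < orient A B P := by grind
        simp [lineElement, downElement, h1, not_le_of_gt h2, this, h3, FreeGroup.of]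
      · have : ¬ orient A B P < 0 := by grind
        simp [lineElement, downElement, not_le_of_gt h1, h2, hP, hQ, this, h3, not_lt_of_gt h3,
          FreeGroup.of, FreeGroup.inv_mk, FreeGroup.invRev]
    · rw [crossingElement_eq_one r]
      rw [hl] at l
      rw [hr] at r
      unfold lineElement downElement
      split_ifs <;> first | rfl | exact inv_one.symm | (exfalso; grind)

end Small

/-! ### The class of the Poincaré word in terms of the line PQ -/

theorem eventually_forall_smallFor (P Q : Plane) (L : List Plane) :
    ∀ᶠ ε : ℝ in 𝓝[>] 0, ∀ A ∈ L, SmallFor P Q ε A :=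
  (Filter.eventually_all_finite L.finite_toSet).2 fun A _ => eventually_smallFor P Q A

theorem forall_mem_of_chain {N : Set Plane} {L : List Plane}
    (h : Cycle.Chain (fun A B => segment ℝ A B ⊆ N) (L : Cycle Plane)) : ∀ A ∈ L, A ∈ N := by
  intro A hA
  obtain ⟨s, t, rfl⟩ := List.append_of_mem hA
  have e : ((s ++ A :: t : List Plane) : Cycle Plane) = ((A :: (t ++ s) : List Plane)) :=
    coe_append_comm s (A :: t)
  rw [e, Cycle.chain_coe_cons] at h
  rcases hu : t ++ s with _ | ⟨B, u⟩ <;> rw [hu] at h <;>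
    exact (List.isChain_cons_cons.1 h).1 (left_mem_segment ℝ _ _)

theorem isConj_loopProd_lineElement {P Q P' Q' : Plane} (hPQ : P ≠ Q) {L : List Plane}
    (hL : Cycle.Chain (fun A B => segment ℝ A B ⊆ planeMinus P Q) (L : Cycle Plane))
    (hP' : P' ≠ P) (hQ' : Q' ≠ Q) (hd : Disjoint (ray P P') (ray Q Q'))
    (h' : ∀ A ∈ L, A ∉ ray P P') (h'' : ∀ A ∈ L, A ∉ ray Q Q') :
    IsConj (loopProd (segmentElement P P' Q Q') L) (loopProd (lineElement P Q) L) := by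
  have hLN := forall_mem_of_chain hL
  have hQP' : Q ∉ ray P P' := Set.disjoint_right.1 hd (origin_mem_ray Q Q')
  obtain ⟨ε, hε, hdis⟩ := ((eventually_forall_smallFor P Q L).and
    (eventually_disjoint_right hPQ hP' hQP')).exists
  have hl : ∀ A ∈ L, A ∉ ray P (leftEnd P Q ε) := fun A hA =>
    (hε A hA).not_mem_left hPQ (hLN A hA).1
  have hr : ∀ A ∈ L, A ∉ ray Q (rightEnd P Q ε) := fun A hA =>
    (hε A hA).not_mem_right hPQ (hLN A hA).2
  -- The right ray is moved first; the choice of ε keeps it disjoint from the original left ray in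
  -- the intermediate position.
  refine (isConj_of_change_right hL hQ' (rightEnd_ne hPQ) hd hdis h'' hr).trans
    ((isConj_of_change_left hL hP' (leftEnd_ne hPQ) hdis (disjoint_left_right hPQ) h' hl).trans ?_)
  refine isConj_loopProd_of_gauge (fun _ => 1) hL fun A B hA hB hAB => ?_
  rw [segmentElement_eq_lineElement hPQ (hε A hA) (hε B hB) hAB]
  simp

theorem exists_generalPosition {P Q : Plane} (hPQ : P ≠ Q) (l : ClosedLine (planeMinus P Q)) :
    ∃ P' Q' : Plane, GeneralPosition P P' Q Q' l := by
  obtain ⟨c, hc0, hc⟩ := l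
  induction c using Quotient.inductionOn' with | _ L
  have hLN := forall_mem_of_chain hc
  obtain ⟨ε, hε⟩ := (eventually_forall_smallFor P Q L).exists
  exact ⟨leftEnd P Q ε, rightEnd P Q ε, leftEnd_ne hPQ, rightEnd_ne hPQ, disjoint_left_right hPQ,
    fun A hA => (hε A hA).not_mem_left hPQ (hLN A hA).1,
    fun A hA => (hε A hA).not_mem_right hPQ (hLN A hA).2⟩

/-- The conjugacy class in the free group given by the crossings of a closed line with the line
`PQ`. -/
noncomputable def lineClass (P Q : Plane) (c : Cycle Plane) : ConjClasses (FreeGroup Gen) :=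
  Quotient.lift (s := List.IsRotated.setoid Plane)
    (fun L : List Plane => ConjClasses.mk (loopProd (lineElement P Q) L))
    (fun _ _ h => ConjClasses.mk_eq_mk_iff_isConj.2 (isConj_loopProd_of_isRotated _ h)) c

theorem lineClass_coe (P Q : Plane) (L : List Plane) :
    lineClass P Q (L : Cycle Plane) = ConjClasses.mk (loopProd (lineElement P Q) L) := rfl

theorem wordClass_poincareWord {P Q P' Q' : Plane} (hPQ : P ≠ Q)
    {l : ClosedLine (planeMinus P Q)} (h : GeneralPosition P P' Q Q' l) :
    wordClass (poincareWord P P' Q Q' l) = lineClass P Q l.1 := by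
  obtain ⟨c, hc0, hc⟩ := l
  induction c using Quotient.inductionOn' with | _ L
  change ConjClasses.mk (FreeGroup.mk (listWord P P' Q Q' L)) =
    ConjClasses.mk (loopProd (lineElement P Q) L)
  rw [mk_listWord, ConjClasses.mk_eq_mk_iff_isConj]
  exact isConj_loopProd_lineElement hPQ hc h.left_ne h.right_ne h.disjoint h.left_avoids
    h.right_avoids

/-- Started at B, the product is f(B, C) M f(A, B), conjugate to M f(A, B) f(B, C) = M f(A, C),
where M is the product along the remaining path from C to A. This is the product of the shortened
line. -/
theorem ElementaryCancellation.lineClass_eq {P Q : Plane} (hPQ : P ≠ Q)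
    {l l₁ : ClosedLine (planeMinus P Q)} (h : ElementaryCancellation _ l l₁) :
    lineClass P Q l.1 = lineClass P Q l₁.1 := by
  obtain ⟨B, L, hL, h1, h2, hN⟩ := h
  rw [h1, h2, lineClass_coe, lineClass_coe, ConjClasses.mk_eq_mk_iff_isConj]
  obtain ⟨C, M, rfl⟩ := List.exists_cons_of_ne_nil hL
  have key := lineElement_mul hPQ hN
  rw [List.head_cons] at key
  rcases List.eq_nil_or_concat (C :: M) with h | ⟨K, A, h⟩
  · simp at h
  have hA : (C :: M).getLast hL = A := by simp [h]
  rw [hA] at key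
  simp only [loopProd]
  have e1 : pathProd (lineElement P Q) (B :: (C :: M ++ [B])) =
      lineElement P Q B C * (pathProd (lineElement P Q) (C :: M) * lineElement P Q A B) := by
    rw [List.cons_append, pathProd, ← List.cons_append, h, List.concat_eq_append,
      List.append_assoc]
    simp only [List.cons_append, List.nil_append]
    rw [pathProd_append]
    simp [pathProd]
  have e2 : pathProd (lineElement P Q) (C :: (M ++ [C])) =
      pathProd (lineElement P Q) (C :: M) * lineElement P Q A C := by
    rw [← List.cons_append, h, List.concat_eq_append, List.append_assoc]
    simp only [List.cons_append, List.nil_append]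
    rw [pathProd_append]
    simp [pathProd]
  rw [e1, e2, ← key, ← mul_assoc (pathProd _ _)]
  exact isConj_mul_comm _ _

/-! ### Homotopy of paths and of closed lines -/

/-- A cycle of points is a closed polygonal line in `N`. -/
def IsClosedLine (N : Set Plane) (c : Cycle Plane) : Prop :=
  c ≠ Cycle.nil ∧ c.Chain (fun A B => segment ℝ A B ⊆ N)

/-- Two cycles of points are homotopic closed lines in `N`, or none of them is a closed line. -/
def CycleHomotopic (N : Set Plane) (c d : Cycle Plane) : Prop :=
  (IsClosedLine N c ↔ IsClosedLine N d) ∧ ∀ (hc : IsClosedLine N c) (hd : IsClosedLine N d),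
    homotopyClass (⟨c, hc⟩ : ClosedLine N) = homotopyClass ⟨d, hd⟩

namespace CycleHomotopic

variable {N : Set Plane} {c d e : Cycle Plane}

theorem refl (c : Cycle Plane) : CycleHomotopic N c c := ⟨Iff.rfl, fun _ _ => rfl⟩

theorem symm (h : CycleHomotopic N c d) : CycleHomotopic N d c :=
  ⟨h.1.symm, fun hc hd => (h.2 hd hc).symm⟩

theorem trans (h : CycleHomotopic N c d) (h' : CycleHomotopic N d e) : CycleHomotopic N c e :=
  ⟨h.1.trans h'.1, fun hc he => (h.2 hc (h.1.1 hc)).trans (h'.2 _ he)⟩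

end CycleHomotopic

/-- The elementary transformations of polygonal paths with fixed end points: removal of a vertex
inside the path whose triangle lies in `N`, and removal of a repeated vertex. -/
inductive PathStep (N : Set Plane) : List Plane → List Plane → Prop
  | triangle (X : List Plane) (A B C : Plane) (Y : List Plane)
      (h : convexHull ℝ {A, B, C} ⊆ N) : PathStep N (X ++ A :: B :: C :: Y) (X ++ A :: C :: Y)
  | dup (X : List Plane) (A : Plane) (Y : List Plane) :
      PathStep N (X ++ A :: A :: Y) (X ++ A :: Y)

/-- Homotopy of polygonal paths with fixed end points. -/
def PathHomotopic (N : Set Plane) : List Plane → List Plane → Prop := Relation.EqvGen (PathStep N)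

theorem chain_cons_cons_append {r : Plane → Plane → Prop} {A B C : Plane} {T : List Plane} :
    Cycle.Chain r ((B :: C :: (T ++ [A]) : List Plane) : Cycle Plane) ↔
      r B C ∧ (C :: (T ++ [A])).IsChain r ∧ r A B := by
  rw [Cycle.chain_coe_cons]
  simp only [List.cons_append, List.append_assoc, List.nil_append, List.isChain_cons_cons]
  rw [← List.cons_append, List.isChain_split]
  simp

theorem chain_cons_append {r : Plane → Plane → Prop} {A C : Plane} {T : List Plane} :
    Cycle.Chain r ((C :: (T ++ [A]) : List Plane) : Cycle Plane) ↔
      (C :: (T ++ [A])).IsChain r ∧ r A C := by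
  rw [Cycle.chain_coe_cons]
  simp only [List.append_assoc, List.cons_append, List.nil_append]
  rw [← List.cons_append, List.isChain_split]
  simp

theorem coe_ne_nil_iff {L : List Plane} : (L : Cycle Plane) ≠ Cycle.nil ↔ L ≠ [] := by
  rw [Ne, Cycle.coe_eq_nil]

theorem segment_subset_of_triangle {N : Set Plane} {A B : Plane} {s : Set Plane}
    (h : convexHull ℝ s ⊆ N) (hA : A ∈ s) (hB : B ∈ s) : segment ℝ A B ⊆ N :=
  ((convex_convexHull ℝ s).segment_subset (subset_convexHull ℝ s hA)
    (subset_convexHull ℝ s hB)).trans h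

theorem PathStep.cycleHomotopic {N : Set Plane} {L M : List Plane} (h : PathStep N L M) :
    CycleHomotopic N L M := by
  cases h with
  | triangle X A B C Y h =>
    have e1 : ((X ++ A :: B :: C :: Y : List Plane) : Cycle Plane) =
        ((B :: C :: ((Y ++ X) ++ [A]) : List Plane) : Cycle Plane) := by
      have := coe_append_comm (X ++ [A]) (B :: C :: Y)
      simpa using this
    have e2 : ((X ++ A :: C :: Y : List Plane) : Cycle Plane) =
        ((C :: ((Y ++ X) ++ [A]) : List Plane) : Cycle Plane) := by
      have := coe_append_comm (X ++ [A]) (C :: Y)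
      simpa using this
    rw [e1, e2]
    refine ⟨?_, fun hc hd => Quotient.sound (.rel _ _ ⟨B, C :: ((Y ++ X) ++ [A]), by simp, rfl, rfl,
      ?_⟩)⟩
    · simp only [IsClosedLine, coe_ne_nil_iff, chain_cons_cons_append, chain_cons_append]
      have h1 : segment ℝ A B ⊆ N := segment_subset_of_triangle h (by simp) (by simp)
      have h2 : segment ℝ B C ⊆ N := segment_subset_of_triangle h (by simp) (by simp)
      have h3 : segment ℝ A C ⊆ N := segment_subset_of_triangle h (by simp) (by simp)
      simp [h1, h2, h3]
    · simpa using h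
  | dup X A Y =>
    have e1 : ((X ++ A :: A :: Y : List Plane) : Cycle Plane) =
        ((A :: A :: (Y ++ X) : List Plane) : Cycle Plane) := coe_append_comm X (A :: A :: Y)
    have e2 : ((X ++ A :: Y : List Plane) : Cycle Plane) =
        ((A :: (Y ++ X) : List Plane) : Cycle Plane) := coe_append_comm X (A :: Y)
    rw [e1, e2]
    generalize Y ++ X = T
    -- Removing a repeated vertex is an elementary cancellation with a degenerate triangle: a point
    -- if nothing else is left, otherwise the side from the preceding vertex Z to A.
    rcases List.eq_nil_or_concat T with rfl | ⟨S, Z, rfl⟩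
    · refine ⟨by simp [IsClosedLine, Cycle.chain_coe_cons], fun hc hd =>
        Quotient.sound (.rel _ _ ⟨A, [A], by simp, rfl, rfl, ?_⟩)⟩
      have h := hd.2
      simpa [Cycle.chain_coe_cons] using h
    · rw [List.concat_eq_append]
      refine ⟨?_, fun hc hd => Quotient.sound
        (.rel _ _ ⟨A, A :: (S ++ [Z]), by simp, rfl, rfl, ?_⟩)⟩
      · simp only [IsClosedLine, coe_ne_nil_iff, chain_cons_cons_append, chain_cons_append]
        have : segment ℝ Z A ⊆ N → segment ℝ A A ⊆ N := fun h => by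
          rw [segment_same, Set.singleton_subset_iff]
          exact h (right_mem_segment ℝ Z A)
        simp only [ne_eq, reduceCtorEq, not_false_eq_true, true_and]
        tauto
      · have h := (chain_cons_append.1 hd.2).2
        simpa [convexHull_pair] using h

namespace PathHomotopic

variable {N : Set Plane} {L M K : List Plane}

theorem refl (L : List Plane) : PathHomotopic N L L := Relation.EqvGen.refl _

theorem symm (h : PathHomotopic N L M) : PathHomotopic N M L := Relation.EqvGen.symm _ _ h

theorem trans (h : PathHomotopic N L M) (h' : PathHomotopic N M K) : PathHomotopic N L K :=
  Relation.EqvGen.trans _ _ _ h h'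

theorem cycleHomotopic (h : PathHomotopic N L M) : CycleHomotopic N L M := by
  induction h with
  | rel _ _ h => exact h.cycleHomotopic
  | refl _ => exact .refl _
  | symm _ _ _ ih => exact ih.symm
  | trans _ _ _ _ _ ih1 ih2 => exact ih1.trans ih2

theorem context (h : PathHomotopic N L M) (X Y : List Plane) :
    PathHomotopic N (X ++ L ++ Y) (X ++ M ++ Y) := by
  induction h with
  | rel _ _ h =>
    refine Relation.EqvGen.rel _ _ ?_
    cases h with
    | triangle X' A B C Y' h => simpa using PathStep.triangle (X ++ X') A B C (Y' ++ Y) h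
    | dup X' A Y' => simpa using PathStep.dup (N := N) (X ++ X') A (Y' ++ Y)
  | refl _ => exact .refl _
  | symm _ _ _ ih => exact ih.symm
  | trans _ _ _ _ _ ih1 ih2 => exact ih1.trans ih2

theorem append_left (h : PathHomotopic N L M) (X : List Plane) :
    PathHomotopic N (X ++ L) (X ++ M) := by
  simpa using h.context X []

theorem append_right (h : PathHomotopic N L M) (Y : List Plane) :
    PathHomotopic N (L ++ Y) (M ++ Y) := h.context [] Y

theorem cons (h : PathHomotopic N L M) (A : Plane) : PathHomotopic N (A :: L) (A :: M) :=
  h.append_left [A]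

theorem triangle {A B C T₁ T₂ T₃ : Plane} (h : convexHull ℝ {T₁, T₂, T₃} ⊆ N) (Y : List Plane)
    (hs : ({A, B, C} : Set Plane) ⊆ {T₁, T₂, T₃} := by
      simp [Set.insert_subset_iff]) :
    PathHomotopic N (A :: B :: C :: Y) (A :: C :: Y) :=
  Relation.EqvGen.rel _ _ (.triangle [] A B C Y ((convexHull_mono hs).trans h))

theorem dup (A : Plane) (Y : List Plane) : PathHomotopic N (A :: A :: Y) (A :: Y) :=
  Relation.EqvGen.rel _ _ (.dup [] A Y)

/-- The triangle A, B, A is the segment AB; removing B leaves a repeated vertex. -/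
theorem spur {A B : Plane} (h : segment ℝ A B ⊆ N) (Y : List Plane) :
    PathHomotopic N (A :: B :: A :: Y) (A :: Y) := by
  refine PathHomotopic.trans (Relation.EqvGen.rel _ _ (PathStep.triangle [] A B A Y ?_)) (dup A Y)
  have e : ({A, B, A} : Set Plane) = {A, B} := by ext; simp; tauto
  rwa [e, convexHull_pair]

theorem between {A B X : Plane} (h : segment ℝ A B ⊆ N) (hX : X ∈ segment ℝ A B)
    (Y : List Plane) : PathHomotopic N (A :: X :: B :: Y) (A :: B :: Y) := by
  refine Relation.EqvGen.rel _ _ (.triangle [] A X B Y ((convexHull_min ?_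
    (convex_segment A B)).trans h))
  rintro Z (rfl | rfl | rfl)
  · exact left_mem_segment ℝ _ _
  · exact hX
  · exact right_mem_segment ℝ _ _

end PathHomotopic

/-! ### Triangles in the plane minus P and Q, and standard crossings -/

section Geometry

variable {P Q : Plane}

theorem orient_add_smul (A B : Plane) (s : ℝ) :
    orient P Q (A + s • (B - A)) = (1 - s) * orient P Q A + s * orient P Q B := by
  simp only [orient, Prod.fst_add, Prod.snd_add, Prod.smul_fst, Prod.smul_snd, smul_eq_mul,
    Prod.fst_sub, Prod.snd_sub]
  ring

/-- A triangle, one vertex of which is not on the line `PQ`, lies in the plane minus `P` and `Q` if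
the other two vertices are not on the other side of the line and the opposite side of
the triangle does not contain `P` and `Q`. -/
theorem triangle_subset {T A B : Plane} (hT : orient P Q T ≠ 0)
    (hA : 0 ≤ orient P Q T * orient P Q A) (hB : 0 ≤ orient P Q T * orient P Q B)
    (h : segment ℝ A B ⊆ planeMinus P Q) : convexHull ℝ {T, A, B} ⊆ planeMinus P Q := by
  intro Z hZ
  rw [convexHull_insert (by simp), convexHull_pair, mem_convexJoin] at hZ
  obtain ⟨T', rfl, W, hW, hZ⟩ := hZ
  obtain ⟨r, hr0, hr1, rfl⟩ := mem_segment_iff_exists.1 hW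
  obtain ⟨s, hs0, hs1, rfl⟩ := mem_segment_iff_exists.1 hZ
  by_cases h0 : orient P Q (T' + s • (A + r • (B - A) - T')) = 0
  -- Multiplied by `orient P Q T'`, the height of the point is (1 - s) times a square plus a
  -- nonnegative term, so it vanishes only on the side AB.
  · have h1 : s = 1 := by
      rw [orient_add_smul, orient_add_smul] at h0
      have hpos : 0 < orient P Q T' * orient P Q T' := mul_self_pos.2 hT
      have h2 : (1 - s) * (orient P Q T' * orient P Q T') + s * ((1 - r) *
        (orient P Q T' * orient P Q A) + r * (orient P Q T' * orient P Q B)) = 0 := by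
        linear_combination orient P Q T' * h0
      have h3 : 0 ≤ s * ((1 - r) *
        (orient P Q T' * orient P Q A) + r * (orient P Q T' * orient P Q B)) :=
        mul_nonneg hs0 (add_nonneg (mul_nonneg (by linarith) hA) (mul_nonneg hr0 hB))
      nlinarith
    rw [h1, one_smul, add_sub_cancel]
    exact h hW
  · constructor
    · intro h; rw [h, orient_self_left] at h0; exact h0 rfl
    · intro h; rw [h, orient_self_right] at h0; exact h0 rfl

theorem segment_line_subset (hPQ : P ≠ Q) {σ τ : ℝ} (h0 : 0 < σ * τ)
    (h1 : 0 < (σ - 1) * (τ - 1)) :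
    segment ℝ (P + σ • (Q - P)) (P + τ • (Q - P)) ⊆ planeMinus P Q := by
  intro Z hZ
  obtain ⟨s, hs0, hs1, rfl⟩ := mem_segment_iff_exists.1 hZ
  have e : P + σ • (Q - P) + s • (P + τ • (Q - P) - (P + σ • (Q - P))) =
      P + (σ + s * (τ - σ)) • (Q - P) := by module
  have hu : Q - P ≠ 0 := sub_ne_zero.2 hPQ.symm
  rw [e]
  constructor
  · intro h
    have := (smul_eq_zero.1 (add_eq_left.1 h)).resolve_right hu
    have hσ : 0 < σ * σ := mul_self_pos.2 (by rintro rfl; simp at h0)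
    have h2 : (1 - s) * (σ * σ) + s * (σ * τ) = 0 := by linear_combination σ * this
    have := mul_nonneg hs0 h0.le
    have h3 : s = 1 := by nlinarith
    rw [h3] at h2
    linarith
  · intro h
    have h' : (σ + s * (τ - σ) - 1) • (Q - P) = 0 := by
      rw [sub_smul, one_smul, sub_eq_zero]
      exact eq_sub_of_add_eq' h
    have := (smul_eq_zero.1 h').resolve_right hu
    have hσ : 0 < (σ - 1) * (σ - 1) := mul_self_pos.2 (by intro h; rw [h] at h1; simp at h1)
    have h2 : (1 - s) * ((σ - 1) * (σ - 1)) + s * ((σ - 1) * (τ - 1)) = 0 := by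
      linear_combination (σ - 1) * this
    have := mul_nonneg hs0 h1.le
    have h3 : s = 1 := by nlinarith
    rw [h3] at h2
    linarith

/-- The base point on the left side of `PQ`. -/
noncomputable def upPoint (P Q : Plane) : Plane :=
  P + (1 / 2 : ℝ) • (Q - P) + (-(Q - P).2, (Q - P).1)

/-- The base point on the right side of `PQ`. -/
noncomputable def downPoint (P Q : Plane) : Plane :=
  P + (1 / 2 : ℝ) • (Q - P) - (-(Q - P).2, (Q - P).1)

theorem orient_upPoint (hPQ : P ≠ Q) : 0 < orient P Q (upPoint P Q) := by
  have hn := dot2_self_pos (sub_ne_zero.2 hPQ.symm)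
  simp only [dot2, orient, upPoint, Prod.fst_add, Prod.snd_add, Prod.smul_fst, Prod.smul_snd,
    smul_eq_mul, Prod.fst_sub, Prod.snd_sub] at hn ⊢
  linarith

theorem orient_downPoint (hPQ : P ≠ Q) : orient P Q (downPoint P Q) < 0 := by
  have hn := dot2_self_pos (sub_ne_zero.2 hPQ.symm)
  simp only [dot2, orient, downPoint, Prod.fst_add, Prod.snd_add, Prod.smul_fst, Prod.smul_snd,
    smul_eq_mul, Prod.fst_sub, Prod.snd_sub] at hn ⊢
  linarith

theorem orient_line (τ : ℝ) : orient P Q (P + τ • (Q - P)) = 0 := by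
  rw [orient_add_smul, orient_self_left, orient_self_right]; ring

theorem orient_line_left (τ : ℝ) (B : Plane) :
    orient (P + τ • (Q - P)) B P = τ * orient P Q B := by
  simp only [orient, Prod.fst_add, Prod.snd_add, Prod.smul_fst, Prod.smul_snd,
    smul_eq_mul, Prod.fst_sub, Prod.snd_sub]
  ring

theorem orient_line_right (τ : ℝ) (B : Plane) :
    orient (P + τ • (Q - P)) B Q = (τ - 1) * orient P Q B := by
  simp only [orient, Prod.fst_add, Prod.snd_add, Prod.smul_fst, Prod.smul_snd,
    smul_eq_mul, Prod.fst_sub, Prod.snd_sub]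
  ring

theorem midpoint_mem_segment : P + (1 / 2 : ℝ) • (Q - P) ∈
    segment ℝ (upPoint P Q) (downPoint P Q) := by
  refine mem_segment_iff_exists.2 ⟨1 / 2, by norm_num, by norm_num, ?_⟩
  unfold upPoint downPoint
  module

end Geometry

section Loops

variable {P Q : Plane}

theorem line_mem (hPQ : P ≠ Q) {τ : ℝ} (h0 : τ ≠ 0) (h1 : τ ≠ 1) :
    P + τ • (Q - P) ∈ planeMinus P Q :=
  segment_line_subset hPQ (mul_self_pos.2 h0) (mul_self_pos.2 (sub_ne_zero.2 h1))
    (left_mem_segment ℝ _ _)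

theorem segment_up_down (hPQ : P ≠ Q) :
    segment ℝ (upPoint P Q) (downPoint P Q) ⊆ planeMinus P Q := by
  intro Z hZ
  obtain ⟨s, hs0, hs1, rfl⟩ := mem_segment_iff_exists.1 hZ
  by_cases h0 : orient P Q (upPoint P Q + s • (downPoint P Q - upPoint P Q)) = 0
  · have hU := orient_upPoint hPQ
    have hD : orient P Q (downPoint P Q) = - orient P Q (upPoint P Q) := by
      simp only [orient, upPoint, downPoint, Prod.fst_add, Prod.snd_add, Prod.smul_fst,
        Prod.smul_snd, smul_eq_mul, Prod.fst_sub, Prod.snd_sub]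
      ring
    rw [orient_add_smul, hD] at h0
    have hs : s = 1 / 2 := by
      have : (1 - 2 * s) * orient P Q (upPoint P Q) = 0 := by linear_combination h0
      have := (mul_eq_zero.1 this).resolve_right hU.ne'
      linarith
    have e : upPoint P Q + s • (downPoint P Q - upPoint P Q) = P + (1 / 2 : ℝ) • (Q - P) := by
      rw [hs]; unfold upPoint downPoint; module
    rw [e]
    exact line_mem hPQ (by norm_num) (by norm_num)
  · constructor
    · intro h; rw [h, orient_self_left] at h0; exact h0 rfl
    · intro h; rw [h, orient_self_right] at h0; exact h0 rfl

theorem triangle_up (hPQ : P ≠ Q) {A B : Plane} (hA : 0 ≤ orient P Q A) (hB : 0 ≤ orient P Q B)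
    (h : segment ℝ A B ⊆ planeMinus P Q) :
    convexHull ℝ {upPoint P Q, A, B} ⊆ planeMinus P Q :=
  triangle_subset (orient_upPoint hPQ).ne' (mul_nonneg (orient_upPoint hPQ).le hA)
    (mul_nonneg (orient_upPoint hPQ).le hB) h

theorem triangle_down (hPQ : P ≠ Q) {A B : Plane} (hA : orient P Q A ≤ 0) (hB : orient P Q B ≤ 0)
    (h : segment ℝ A B ⊆ planeMinus P Q) :
    convexHull ℝ {downPoint P Q, A, B} ⊆ planeMinus P Q :=
  triangle_subset (orient_downPoint hPQ).ne
    (mul_nonneg_of_nonpos_of_nonpos (orient_downPoint hPQ).le hA)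
    (mul_nonneg_of_nonpos_of_nonpos (orient_downPoint hPQ).le hB) h

theorem segment_up (hPQ : P ≠ Q) {A : Plane} (hA : 0 ≤ orient P Q A) (h : A ∈ planeMinus P Q) :
    segment ℝ (upPoint P Q) A ⊆ planeMinus P Q :=
  segment_subset_of_triangle (triangle_up hPQ hA hA (by simpa using h)) (by simp) (by simp)

theorem segment_down (hPQ : P ≠ Q) {A : Plane} (hA : orient P Q A ≤ 0) (h : A ∈ planeMinus P Q) :
    segment ℝ (downPoint P Q) A ⊆ planeMinus P Q :=
  segment_subset_of_triangle (triangle_down hPQ hA hA (by simpa using h)) (by simp) (by simp)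

/-- The crossing point X slides along the line PQ to the gate g in the same component. Every
triangle swept has `upPoint` or `downPoint` as a vertex and its other two vertices in the
corresponding closed half-plane, so it misses P and Q. -/
theorem pathHomotopic_cross_down (hPQ : P ≠ Q) {A B X g : Plane}
    (h : segment ℝ A B ⊆ planeMinus P Q) (hX : X ∈ segment ℝ A B) (hA : 0 ≤ orient P Q A)
    (hB : orient P Q B < 0) (hX0 : orient P Q X = 0) (hg0 : orient P Q g = 0)
    (hXg : segment ℝ g X ⊆ planeMinus P Q) :
    PathHomotopic (planeMinus P Q) [upPoint P Q, A, B]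
      [upPoint P Q, g, downPoint P Q, B] := by
  have hAX : segment ℝ A X ⊆ planeMinus P Q :=
    ((convex_segment A B).segment_subset (left_mem_segment ℝ A B) hX).trans h
  have hXB : segment ℝ X B ⊆ planeMinus P Q :=
    ((convex_segment A B).segment_subset hX (right_mem_segment ℝ A B)).trans h
  have s1 : PathHomotopic (planeMinus P Q) [upPoint P Q, A, X, B] [upPoint P Q, A, B] :=
    (PathHomotopic.between h hX []).cons _
  have s2 : PathHomotopic (planeMinus P Q) [upPoint P Q, A, X, B] [upPoint P Q, X, B] :=
    .triangle (triangle_up hPQ hA hX0.ge hAX) _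
  have s3 : PathHomotopic (planeMinus P Q) [upPoint P Q, X, downPoint P Q, B]
      [upPoint P Q, X, B] :=
    (PathHomotopic.triangle (triangle_down hPQ hX0.le hB.le hXB) []).cons _
  have s4 : PathHomotopic (planeMinus P Q) [upPoint P Q, g, X, downPoint P Q, B]
      [upPoint P Q, X, downPoint P Q, B] :=
    .triangle (triangle_up hPQ hg0.ge hX0.ge hXg) _
  have s5 : PathHomotopic (planeMinus P Q) [upPoint P Q, g, X, downPoint P Q, B]
      [upPoint P Q, g, downPoint P Q, B] :=
    (PathHomotopic.triangle (triangle_down hPQ hg0.le hX0.le hXg) [B]).cons _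
  exact s1.symm.trans (s2.trans (s3.symm.trans (s4.symm.trans s5)))

theorem pathHomotopic_cross_up (hPQ : P ≠ Q) {A B X g : Plane}
    (h : segment ℝ A B ⊆ planeMinus P Q) (hX : X ∈ segment ℝ A B) (hA : orient P Q A < 0)
    (hB : 0 ≤ orient P Q B) (hX0 : orient P Q X = 0) (hg0 : orient P Q g = 0)
    (hXg : segment ℝ g X ⊆ planeMinus P Q) :
    PathHomotopic (planeMinus P Q) [upPoint P Q, downPoint P Q, A, B]
      [upPoint P Q, downPoint P Q, g, upPoint P Q, B] := by
  have hAX : segment ℝ A X ⊆ planeMinus P Q :=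
    ((convex_segment A B).segment_subset (left_mem_segment ℝ A B) hX).trans h
  have hXB : segment ℝ X B ⊆ planeMinus P Q :=
    ((convex_segment A B).segment_subset hX (right_mem_segment ℝ A B)).trans h
  refine PathHomotopic.cons ?_ _
  have s1 : PathHomotopic (planeMinus P Q) [downPoint P Q, A, X, B] [downPoint P Q, A, B] :=
    (PathHomotopic.between h hX []).cons _
  have s2 : PathHomotopic (planeMinus P Q) [downPoint P Q, A, X, B] [downPoint P Q, X, B] :=
    .triangle (triangle_down hPQ hA.le hX0.le hAX) _
  have s3 : PathHomotopic (planeMinus P Q) [downPoint P Q, X, upPoint P Q, B]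
      [downPoint P Q, X, B] :=
    (PathHomotopic.triangle (triangle_up hPQ hX0.ge hB hXB) []).cons _
  have s4 : PathHomotopic (planeMinus P Q) [downPoint P Q, g, X, upPoint P Q, B]
      [downPoint P Q, X, upPoint P Q, B] :=
    .triangle (triangle_down hPQ hg0.le hX0.le hXg) _
  have s5 : PathHomotopic (planeMinus P Q) [downPoint P Q, g, X, upPoint P Q, B]
      [downPoint P Q, g, upPoint P Q, B] :=
    (PathHomotopic.triangle (triangle_up hPQ hg0.ge hX0.ge hXg) [B]).cons _
  exact s1.symm.trans (s2.trans (s3.symm.trans (s4.symm.trans s5)))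

end Loops

/-! ### Standard loops and the normal form of a closed line -/

/-- The closed path at `upPoint P Q` corresponding to a letter, without its end point. -/
noncomputable def letterPath (P Q : Plane) : Letter → List Plane
  | (.a, true) => [upPoint P Q, downPoint P Q, P + (-1 : ℝ) • (Q - P)]
  | (.a, false) => [upPoint P Q, P + (-1 : ℝ) • (Q - P), downPoint P Q]
  | (.b, true) => [upPoint P Q, P + (2 : ℝ) • (Q - P), downPoint P Q]
  | (.b, false) => [upPoint P Q, downPoint P Q, P + (2 : ℝ) • (Q - P)]

/-- The closed path at `upPoint P Q` corresponding to a word. -/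
noncomputable def wordPath (P Q : Plane) (w : List Letter) : List Plane :=
  w.flatMap (letterPath P Q) ++ [upPoint P Q]

open Classical in
/-- A path from `upPoint P Q` to a point, without its end point. -/
noncomputable def basePath (P Q A : Plane) : List Plane :=
  if 0 ≤ orient P Q A then [upPoint P Q] else [upPoint P Q, downPoint P Q]

section Normalization

variable {P Q : Plane}

theorem exists_letters_down (hPQ : P ≠ Q) {A B : Plane} (h : segment ℝ A B ⊆ planeMinus P Q)
    (hA : 0 ≤ orient P Q A) (hB : orient P Q B < 0) :
    ∃ w : List Letter, FreeGroup.mk w = downElement P Q A B ∧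
      PathHomotopic (planeMinus P Q) [upPoint P Q, A, B]
        (w.flatMap (letterPath P Q) ++ [upPoint P Q, downPoint P Q, B]) := by
  obtain ⟨τ, hτ, h1, h2⟩ := exists_mem_segment_line hPQ hA hB
  -- The gate parameter σ will be -1, 2 or 1/2, according to the component of the line that contains
  -- the crossing point.
  have key := fun σ k k' => pathHomotopic_cross_down hPQ h hτ hA hB (orient_line τ)
    (orient_line σ) (segment_line_subset hPQ (σ := σ) k k')
  have hDU : segment ℝ (downPoint P Q) (upPoint P Q) ⊆ planeMinus P Q :=
    segment_symm ℝ (upPoint P Q) (downPoint P Q) ▸ segment_up_down hPQ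
  have τ0 : τ ≠ 0 := fun k => (h hτ).1 (by simp [k])
  have τ1 : τ ≠ 1 := fun k => (h hτ).2 (by simp [k])
  unfold downElement
  split_ifs with c c'
  · have hneg : τ < 0 := by by_contra! k; nlinarith
    exact ⟨[(.a, false)], by simp [FreeGroup.of, FreeGroup.inv_mk, FreeGroup.invRev],
      (key (-1) (by linarith) (by linarith)).trans
        -- Inserting a detour from `downPoint` to `upPoint` and back closes the loop of the letter.
        (((PathHomotopic.spur hDU [B]).symm.cons _).cons _)⟩
  · have hpos : 1 < τ := by by_contra! k; nlinarith
    exact ⟨[(.b, true)], rfl, (key 2 (by linarith) (by linarith)).trans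
        (((PathHomotopic.spur hDU [B]).symm.cons _).cons _)⟩
  · have hpos : 0 < τ := by
      refine lt_of_le_of_ne ?_ τ0.symm
      by_contra! k; nlinarith
    have hlt : τ < 1 := by
      refine lt_of_le_of_ne ?_ τ1
      by_contra! k; nlinarith
    exact ⟨[], FreeGroup.one_eq_mk.symm, (key (1 / 2) (by linarith) (by linarith)).trans
        (PathHomotopic.between (segment_up_down hPQ) midpoint_mem_segment [B])⟩

theorem exists_letters_up (hPQ : P ≠ Q) {A B : Plane} (h : segment ℝ A B ⊆ planeMinus P Q)
    (hA : orient P Q A < 0) (hB : 0 ≤ orient P Q B) :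
    ∃ w : List Letter, FreeGroup.mk w = (downElement P Q B A)⁻¹ ∧
      PathHomotopic (planeMinus P Q) [upPoint P Q, downPoint P Q, A, B]
        (w.flatMap (letterPath P Q) ++ [upPoint P Q, B]) := by
  obtain ⟨τ, hτ, h1, h2⟩ := exists_mem_segment_line hPQ hB hA
  rw [segment_symm] at hτ
  have key := fun σ k k' => pathHomotopic_cross_up hPQ h hτ hA hB (orient_line τ)
    (orient_line σ) (segment_line_subset hPQ (σ := σ) k k')
  have hDU : segment ℝ (downPoint P Q) (upPoint P Q) ⊆ planeMinus P Q :=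
    segment_symm ℝ (upPoint P Q) (downPoint P Q) ▸ segment_up_down hPQ
  have hM : P + (1 / 2 : ℝ) • (Q - P) ∈ segment ℝ (downPoint P Q) (upPoint P Q) :=
    segment_symm ℝ (upPoint P Q) (downPoint P Q) ▸ midpoint_mem_segment
  have τ0 : τ ≠ 0 := fun k => (h hτ).1 (by simp [k])
  have τ1 : τ ≠ 1 := fun k => (h hτ).2 (by simp [k])
  unfold downElement
  split_ifs with c c'
  · have hneg : τ < 0 := by by_contra! k; nlinarith
    exact ⟨[(.a, true)], by simp [FreeGroup.of], key (-1) (by linarith) (by linarith)⟩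
  · have hpos : 1 < τ := by by_contra! k; nlinarith
    exact ⟨[(.b, false)], by simp [FreeGroup.of, FreeGroup.inv_mk, FreeGroup.invRev],
      key 2 (by linarith) (by linarith)⟩
  · have hpos : 0 < τ := by
      refine lt_of_le_of_ne ?_ τ0.symm
      by_contra! k; nlinarith
    have hlt : τ < 1 := by
      refine lt_of_le_of_ne ?_ τ1
      by_contra! k; nlinarith
    exact ⟨[], by rw [inv_one, FreeGroup.one_eq_mk],
      (key (1 / 2) (by linarith) (by linarith)).trans
        (((PathHomotopic.between hDU hM [B]).cons _).trans
          (PathHomotopic.spur (segment_up_down hPQ) [B]))⟩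

theorem exists_letters (hPQ : P ≠ Q) {A B : Plane} (h : segment ℝ A B ⊆ planeMinus P Q) :
    ∃ w : List Letter, FreeGroup.mk w = lineElement P Q A B ∧
      PathHomotopic (planeMinus P Q) (basePath P Q A ++ [A, B])
        (w.flatMap (letterPath P Q) ++ (basePath P Q B ++ [B])) := by
  unfold lineElement basePath
  split_ifs with a b b
  · exact ⟨[], FreeGroup.one_eq_mk.symm, .triangle (triangle_up hPQ a b h) _⟩
  · exact exists_letters_down hPQ h a (not_le.1 b)
  · exact exists_letters_up hPQ h (not_le.1 a) b
  · exact ⟨[], FreeGroup.one_eq_mk.symm, (PathHomotopic.triangle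
      (triangle_down hPQ (not_le.1 a).le (not_le.1 b).le h) []).cons _⟩

theorem exists_word (hPQ : P ≠ Q) {A B : Plane} {L : List Plane}
    (h : (A :: (L ++ [B])).IsChain fun A B => segment ℝ A B ⊆ planeMinus P Q) :
    ∃ w : List Letter, FreeGroup.mk w = pathProd (lineElement P Q) (A :: (L ++ [B])) ∧
      PathHomotopic (planeMinus P Q) (basePath P Q A ++ A :: (L ++ [B]))
        (w.flatMap (letterPath P Q) ++ (basePath P Q B ++ [B])) := by
  induction L generalizing A with
  | nil =>
    simp only [List.nil_append, List.isChain_cons_cons] at h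
    simpa [pathProd] using exists_letters hPQ h.1
  | cons C L ih =>
    simp only [List.cons_append] at h ⊢
    rw [List.isChain_cons_cons] at h
    obtain ⟨v, hv, hv'⟩ := exists_letters hPQ h.1
    obtain ⟨w, hw, hw'⟩ := ih h.2
    refine ⟨v ++ w, by rw [pathProd, ← FreeGroup.mul_mk, hv, hw], ?_⟩
    have s1 := hv'.append_right (L ++ [B])
    have s2 := hw'.append_left (v.flatMap (letterPath P Q))
    simp only [List.append_assoc, List.cons_append, List.nil_append, List.flatMap_append]
      at s1 s2 ⊢
    exact s1.trans s2

theorem basePath_contract (hPQ : P ≠ Q) {A : Plane} (hA : A ∈ planeMinus P Q) :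
    PathHomotopic (planeMinus P Q) (basePath P Q A ++ A :: A :: (basePath P Q A).reverse)
      [upPoint P Q] := by
  unfold basePath
  split_ifs with a
  · exact ((PathHomotopic.dup _ _).cons _).trans
      ((PathHomotopic.spur (segment_up hPQ a hA) []))
  · exact (((PathHomotopic.dup _ _).cons _).cons _).trans
      (((PathHomotopic.spur (segment_down hPQ (not_le.1 a).le hA) _).cons _).trans
        (PathHomotopic.spur (segment_up_down hPQ) []))

theorem reverse_basePath_contract (hPQ : P ≠ Q) {A : Plane} (hA : A ∈ planeMinus P Q) :
    PathHomotopic (planeMinus P Q) (A :: ((basePath P Q A).reverse ++ (basePath P Q A ++ [A])))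
      [A] := by
  have sub := segment_symm ℝ (upPoint P Q) (downPoint P Q) ▸ segment_up_down hPQ
  unfold basePath
  split_ifs with a
  · exact ((PathHomotopic.dup _ _).cons _).trans
      ((PathHomotopic.spur (segment_symm ℝ A _ ▸ segment_up hPQ a hA) []))
  · exact (((PathHomotopic.dup _ _).cons _).cons _).trans
      (((PathHomotopic.spur sub _).cons _).trans
        (PathHomotopic.spur (segment_symm ℝ A _ ▸ segment_down hPQ (not_le.1 a).le hA) []))

/-- Every closed line is homotopic to the standard closed line of a word in the class of
the line. -/
theorem exists_word_cycleHomotopic (hPQ : P ≠ Q) {c : Cycle Plane}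
    (hc : IsClosedLine (planeMinus P Q) c) :
    ∃ w : List Letter, wordClass (w : CyclicWord) = lineClass P Q c ∧
      CycleHomotopic (planeMinus P Q) c (wordPath P Q w) := by
  induction c using Quotient.inductionOn' with | _ L
  obtain ⟨hL, hchain⟩ := hc
  obtain ⟨A, L, rfl⟩ := List.exists_cons_of_ne_nil (coe_ne_nil_iff.1 hL)
  have hA := forall_mem_of_chain hchain A (by simp)
  obtain ⟨w, hw, hw'⟩ := exists_word hPQ (Cycle.chain_coe_cons _ _ _ |>.1 hchain)
  refine ⟨w, by rw [wordClass_coe, hw]; rfl, ?_⟩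
  change CycleHomotopic _ ((A :: L : List Plane) : Cycle Plane) _
  -- Repeat A, insert the base path of A back and forth, and replace the line by the loops of w. A
  -- rotation then brings the base path and its reverse together at the end, where they contract to
  -- the base point.
  have s1 : CycleHomotopic (planeMinus P Q) ((A :: (L ++ [A]) : List Plane) : Cycle Plane)
      ((A :: L : List Plane) : Cycle Plane) := by
    have e : ((A :: (L ++ [A]) : List Plane) : Cycle Plane) = ((A :: A :: L : List Plane)) :=
      coe_append_comm (A :: L) [A]
    rw [e]
    exact (PathHomotopic.dup A L).cycleHomotopic
  have s2 := ((reverse_basePath_contract hPQ hA).append_right (L ++ [A])).cycleHomotopic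
  have s3 := (hw'.append_left (A :: (basePath P Q A).reverse)).cycleHomotopic
  have s4 := ((basePath_contract hPQ hA).append_left (w.flatMap (letterPath P Q))).cycleHomotopic
  have e := coe_append_comm (A :: (basePath P Q A).reverse)
    (w.flatMap (letterPath P Q) ++ (basePath P Q A ++ [A]))
  simp only [List.append_assoc, List.cons_append, List.nil_append] at s2 s3 s4 e
  rw [e] at s3
  exact s1.symm.trans (s2.symm.trans (s3.trans s4))

theorem flatMap_letterPath_append (w : List Letter) (Y : List Plane) :
    ∃ Z, w.flatMap (letterPath P Q) ++ upPoint P Q :: Y = upPoint P Q :: Z := by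
  rcases w with _ | ⟨⟨_ | _, _ | _⟩, w⟩
  · exact ⟨_, rfl⟩
  all_goals exact ⟨_, by simp [letterPath]; rfl⟩

theorem wordPath_append (v w : List Letter) : PathHomotopic (planeMinus P Q)
    (wordPath P Q v ++ wordPath P Q w) (wordPath P Q (v ++ w)) := by
  obtain ⟨Z, hZ⟩ := flatMap_letterPath_append (P := P) (Q := Q) w []
  unfold wordPath
  rw [List.flatMap_append, List.append_assoc, List.append_assoc, hZ]
  exact (PathHomotopic.dup _ Z).append_left _

theorem wordPath_cycleHomotopic_of_isRotated {v w : List Letter} (h : v ~r w) :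
    CycleHomotopic (planeMinus P Q) (wordPath P Q v) (wordPath P Q w) := by
  obtain ⟨s, t, rfl, rfl⟩ := exists_append_of_isRotated h
  have h1 := (wordPath_append (P := P) (Q := Q) s t).cycleHomotopic
  rw [coe_append_comm] at h1
  exact h1.symm.trans (wordPath_append t s).cycleHomotopic

theorem gate_mem (hPQ : P ≠ Q) : P + (-1 : ℝ) • (Q - P) ∈ planeMinus P Q ∧
    P + (2 : ℝ) • (Q - P) ∈ planeMinus P Q :=
  ⟨line_mem hPQ (by norm_num) (by norm_num), line_mem hPQ (by norm_num) (by norm_num)⟩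

/-- The loops of a letter and of its inverse visit the same two intermediate vertices in opposite
orders, so their concatenation collapses from the middle by spurs. -/
theorem wordPath_cancel (hPQ : P ≠ Q) (x : Letter) (w : List Letter) :
    PathHomotopic (planeMinus P Q) (wordPath P Q (x :: x.inverse :: w)) (wordPath P Q w) := by
  obtain ⟨Z, hZ⟩ := flatMap_letterPath_append (P := P) (Q := Q) w []
  unfold wordPath
  rw [List.flatMap_cons, List.flatMap_cons, List.append_assoc, List.append_assoc, hZ]
  have key : ∀ X Y : Plane, segment ℝ (upPoint P Q) X ⊆ planeMinus P Q →
      segment ℝ X Y ⊆ planeMinus P Q → segment ℝ Y (upPoint P Q) ⊆ planeMinus P Q →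
      PathHomotopic (planeMinus P Q)
        (upPoint P Q :: X :: Y :: upPoint P Q :: Y :: X :: upPoint P Q :: Z)
        (upPoint P Q :: Z) := by
    intro X Y h1 h2 h3
    exact (((PathHomotopic.spur h3 _).cons _).cons _).trans
      (((PathHomotopic.spur h2 _).cons _).trans (PathHomotopic.spur h1 _))
  have hUD := segment_up_down hPQ
  have hDU := segment_symm ℝ (upPoint P Q) (downPoint P Q) ▸ hUD
  obtain ⟨hl, hr⟩ := gate_mem hPQ
  have hUl := segment_up hPQ (orient_line _).ge hl
  have hUr := segment_up hPQ (orient_line _).ge hr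
  have hDl := segment_down hPQ (orient_line _).le hl
  have hDr := segment_down hPQ (orient_line _).le hr
  rcases x with ⟨_ | _, _ | _⟩
  · exact key _ _ hUl (segment_symm ℝ _ (downPoint P Q) ▸ hDl) hDU
  · exact key _ _ hUD hDl (segment_symm ℝ (upPoint P Q) _ ▸ hUl)
  · exact key _ _ hUD hDr (segment_symm ℝ (upPoint P Q) _ ▸ hUr)
  · exact key _ _ hUr (segment_symm ℝ _ (downPoint P Q) ▸ hDr) hDU

theorem wordPath_cycleHomotopic_of_eqvGen (hPQ : P ≠ Q) {c d : CyclicWord}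
    (h : Relation.EqvGen WordCancellation c d) : ∀ v w : List Letter, (v : CyclicWord) = c →
      (w : CyclicWord) = d →
      CycleHomotopic (planeMinus P Q) (wordPath P Q v) (wordPath P Q w) := by
  induction h with
  | rel _ _ h =>
    rintro v w rfl rfl
    obtain ⟨x, u, h1, h2⟩ := h
    exact (wordPath_cycleHomotopic_of_isRotated (Cycle.coe_eq_coe.1 h1)).trans
      ((wordPath_cancel hPQ x u).cycleHomotopic.trans
        (wordPath_cycleHomotopic_of_isRotated (Cycle.coe_eq_coe.1 h2.symm)))
  | refl _ =>
    rintro v w rfl h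
    exact wordPath_cycleHomotopic_of_isRotated (Cycle.coe_eq_coe.1 h.symm)
  | symm _ _ _ ih => exact fun v w hv hw => (ih w v hw hv).symm
  | trans _ d _ _ _ ih1 ih2 =>
    intro v w hv hw
    obtain ⟨u, hu⟩ := Quotient.exists_rep d
    exact (ih1 v u hv hu).trans (ih2 u w hu hw)

theorem homotopyClass_eq_of_lineClass_eq (hPQ : P ≠ Q) {l m : ClosedLine (planeMinus P Q)}
    (h : lineClass P Q l.1 = lineClass P Q m.1) : homotopyClass l = homotopyClass m := by
  obtain ⟨v, hv, hv'⟩ := exists_word_cycleHomotopic hPQ l.2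
  obtain ⟨w, hw, hw'⟩ := exists_word_cycleHomotopic hPQ m.2
  have hvw := eqvGen_of_wordClass_eq (hv.trans (h.trans hw.symm))
  exact (hv'.trans ((wordPath_cycleHomotopic_of_eqvGen hPQ hvw v w rfl rfl).trans hw'.symm)).2
    l.2 m.2

theorem letterPath_spec (hPQ : P ≠ Q) (x : Letter) (Z : List Plane) :
    pathProd (lineElement P Q) (letterPath P Q x ++ upPoint P Q :: Z) =
      FreeGroup.mk [x] * pathProd (lineElement P Q) (upPoint P Q :: Z) ∧
    ((upPoint P Q :: Z).IsChain (fun A B => segment ℝ A B ⊆ planeMinus P Q) →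
      (letterPath P Q x ++ upPoint P Q :: Z).IsChain
        fun A B => segment ℝ A B ⊆ planeMinus P Q) := by
  have hU := orient_upPoint hPQ
  have hD := orient_downPoint hPQ
  have hUD := segment_up_down hPQ
  have hDU := segment_symm ℝ (upPoint P Q) (downPoint P Q) ▸ hUD
  obtain ⟨hl, hr⟩ := gate_mem hPQ
  have hUl := segment_up hPQ (orient_line _).ge hl
  have hUr := segment_up hPQ (orient_line _).ge hr
  have hDl := segment_down hPQ (orient_line _).le hl
  have hDr := segment_down hPQ (orient_line _).le hr
  have hlU := segment_symm ℝ (upPoint P Q) _ ▸ hUl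
  have hrU := segment_symm ℝ (upPoint P Q) _ ▸ hUr
  have hlD := segment_symm ℝ (downPoint P Q) _ ▸ hDl
  have hrD := segment_symm ℝ (downPoint P Q) _ ▸ hDr
  have e0 : downElement P Q (upPoint P Q) (downPoint P Q) = 1 := by
    have hn := dot2_self_pos (sub_ne_zero.2 hPQ.symm)
    unfold downElement
    rw [if_neg, if_neg]
    · simp only [dot2, orient, upPoint, downPoint, Prod.fst_add, Prod.snd_add, Prod.smul_fst,
        Prod.smul_snd, smul_eq_mul, Prod.fst_sub, Prod.snd_sub] at hn ⊢
      linarith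
    · simp only [dot2, orient, upPoint, downPoint, Prod.fst_add, Prod.snd_add, Prod.smul_fst,
        Prod.smul_snd, smul_eq_mul, Prod.fst_sub, Prod.snd_sub] at hn ⊢
      linarith
  have e1 : downElement P Q (P + (-1 : ℝ) • (Q - P)) (downPoint P Q) = (FreeGroup.of .a)⁻¹ := by
    unfold downElement
    rw [if_pos]
    rw [orient_line_left]
    linarith
  have e2 : downElement P Q (P + (2 : ℝ) • (Q - P)) (downPoint P Q) = FreeGroup.of .b := by
    unfold downElement
    rw [if_neg, if_pos]
    · rw [orient_line_right]; linarith
    · rw [orient_line_left]; linarith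
  have ha : FreeGroup.mk [((.a, false) : Letter)] = (FreeGroup.of .a)⁻¹ := rfl
  have hb : FreeGroup.mk [((.b, false) : Letter)] = (FreeGroup.of .b)⁻¹ := rfl
  have ha' : FreeGroup.mk [((.a, true) : Letter)] = FreeGroup.of .a := rfl
  have hb' : FreeGroup.mk [((.b, true) : Letter)] = FreeGroup.of .b := rfl
  rcases x with ⟨_ | _, _ | _⟩ <;>
    simp only [letterPath, List.cons_append, List.nil_append, pathProd, List.isChain_cons_cons,
      lineElement, hU.le, not_le_of_gt hD, orient_line, le_refl, if_true, if_false, e0, e1, e2,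
      ha, hb, ha', hb', inv_one, inv_inv, one_mul, true_and]
  · exact fun h => ⟨hUl, hlD, hDU, h⟩
  · exact fun h => ⟨hUD, hDl, hlU, h⟩
  · exact fun h => ⟨hUD, hDr, hrU, h⟩
  · exact fun h => ⟨hUr, hrD, hDU, h⟩

theorem wordPath_spec (hPQ : P ≠ Q) (w : List Letter) (Z : List Plane)
    (hZ : (upPoint P Q :: Z).IsChain fun A B => segment ℝ A B ⊆ planeMinus P Q) :
    pathProd (lineElement P Q) (w.flatMap (letterPath P Q) ++ upPoint P Q :: Z) =
      FreeGroup.mk w * pathProd (lineElement P Q) (upPoint P Q :: Z) ∧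
    (w.flatMap (letterPath P Q) ++ upPoint P Q :: Z).IsChain
        fun A B => segment ℝ A B ⊆ planeMinus P Q := by
  induction w with
  | nil => exact ⟨by rw [← FreeGroup.one_eq_mk, one_mul]; rfl, hZ⟩
  | cons x w ih =>
    obtain ⟨Y, hY⟩ := flatMap_letterPath_append (P := P) (Q := Q) w Z
    rw [hY] at ih
    have h := letterPath_spec hPQ x Y
    rw [List.flatMap_cons, List.append_assoc, hY]
    refine ⟨?_, h.2 ih.2⟩
    rw [h.1, ih.1, ← mul_assoc, FreeGroup.mul_mk]
    rfl

theorem exists_line_of_word (hPQ : P ≠ Q) (w : List Letter) :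
    ∃ l : ClosedLine (planeMinus P Q), lineClass P Q l.1 = wordClass (w : CyclicWord) := by
  have hU := orient_upPoint hPQ
  have hUU : segment ℝ (upPoint P Q) (upPoint P Q) ⊆ planeMinus P Q :=
    fun Z hZ => segment_up_down hPQ (by
      rw [segment_same] at hZ
      rw [hZ]
      exact left_mem_segment ℝ _ _)
  have h := wordPath_spec hPQ w [upPoint P Q] (by simpa using hUU)
  obtain ⟨Z, hZ⟩ := flatMap_letterPath_append (P := P) (Q := Q) w []
  -- The last vertex of `wordPath` is the base point again, so closing up repeats it; the extra
  -- factor `lineElement` from the base point to itself is 1.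
  have hZ' : w.flatMap (letterPath P Q) ++ [upPoint P Q, upPoint P Q] =
      upPoint P Q :: (Z ++ [upPoint P Q]) := by
    rw [← List.cons_append, ← hZ]; simp
  rw [hZ'] at h
  refine ⟨⟨((upPoint P Q :: Z : List Plane) : Cycle Plane), coe_ne_nil_iff.2 (by simp),
    (Cycle.chain_coe_cons _ _ _).2 h.2⟩, ?_⟩
  rw [lineClass_coe, wordClass_coe, loopProd, h.1]
  simp [pathProd, lineElement, hU.le]

theorem lineClass_eq_iff (hPQ : P ≠ Q) {l m : ClosedLine (planeMinus P Q)} :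
    lineClass P Q l.1 = lineClass P Q m.1 ↔ homotopyClass l = homotopyClass m := by
  refine ⟨homotopyClass_eq_of_lineClass_eq hPQ, fun h => ?_⟩
  replace h : Relation.EqvGen (ElementaryCancellation _) l m := Quotient.exact h
  induction h with
  | rel _ _ h => exact h.lineClass_eq hPQ
  | refl _ => rfl
  | symm _ _ _ ih => exact ih.symm
  | trans _ _ _ _ _ ih1 ih2 => exact ih1.trans ih2

end Normalization

end PolyLine

/-! ### The bijection -/

theorem proposition7p7 (P Q : PolyLine.Plane) (hPQ : P ≠ Q) :
    (∀ l : PolyLine.ClosedLine (PolyLine.planeMinus P Q),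
      ∃ P' Q' : PolyLine.Plane, PolyLine.GeneralPosition P P' Q Q' l) ∧
    ∃ Φ : PolyLine.HomotopyClass (PolyLine.planeMinus P Q) → PolyLine.EconomicalWord,
      (∀ (l : PolyLine.ClosedLine (PolyLine.planeMinus P Q)) (P' Q' : PolyLine.Plane),
        PolyLine.GeneralPosition P P' Q Q' l →
          ∀ e : PolyLine.EconomicalWord,
            PolyLine.IsEconomicalForm (PolyLine.poincareWord P P' Q Q' l) e ↔
              e = Φ (PolyLine.homotopyClass l)) ∧
      Function.Bijective Φ := by
  open PolyLine in
  refine ⟨exists_generalPosition hPQ, ?_⟩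
  -- The value of the map is the economical word whose conjugacy class is that of any line in the
  -- homotopy class.
  have hex : ∀ h : HomotopyClass (planeMinus P Q), ∃ e : EconomicalWord,
      ∀ l, homotopyClass l = h → wordClass e.1 = lineClass P Q l.1 := by
    intro h
    obtain ⟨l, rfl⟩ := Quotient.exists_rep h
    obtain ⟨e, he⟩ := exists_economical_wordClass_eq (lineClass P Q l.1)
    exact ⟨e, fun m hm => he.trans ((lineClass_eq_iff hPQ).2 hm.symm)⟩
  choose Φ hΦ using hex
  refine ⟨Φ, fun l P' Q' hgp e => ?_, ?_, ?_⟩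
  · rw [isEconomicalForm_iff, wordClass_poincareWord hPQ hgp, ← hΦ _ l rfl]
    exact ⟨fun h => (wordClass_injective_on_economical h).symm, fun h => by rw [h]⟩
  · intro h h' heq
    obtain ⟨l, rfl⟩ := Quotient.exists_rep h
    obtain ⟨m, rfl⟩ := Quotient.exists_rep h'
    refine (lineClass_eq_iff hPQ).1 ?_
    rw [← hΦ _ l rfl, ← hΦ _ m rfl]
    exact congrArg (fun e : EconomicalWord => wordClass e.1) heq
  · intro e
    obtain ⟨w, hw⟩ := Quotient.exists_rep e.1
    obtain ⟨l, hl⟩ := exists_line_of_word hPQ w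
    refine ⟨homotopyClass l, wordClass_injective_on_economical ?_⟩
    rw [hΦ _ l rfl, hl, ← hw]
    rfl
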